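/- Let $Q_n$ be the $n$-dimensional hypercube: its vertices are the words $u=u^1\cdots u^n$ with $u^i\in\{0,1\}$, and two vertices are adjacent if and only if they differ in exactly one coordinate. Write $p(u)=\sum_{i=1}^n u^i \pmod 2$ for the parity of a vertex $u$. Let $n\ge 6$, let $e_1,e_2$ be edges of $Q_n$ (not necessarily distinct), and let $u,v,x,y$ be pairwise distinct vertices of $Q_n$ with $p(u)\ne p(v)$ and $p(x)\ne p(y)$. Suppose that neither $x$ nor $y$ is an endpoint of $e_1$ or of $e_2$, and that, if $e_1\ne e_2$, neither $u$ nor $v$ is an endpoint of both $e_1$ and $e_2$. (The last condition holds in particular whenever $e_1$ and $e_2$ are disjoint.) Then $Q_n$ has a spanning $2$-path $P_{uv}+P_{xy}$ that contains both $e_1$ and $e_2$; that is, there are a path $P_{uv}$ with endpoints $u,v$ and a path $P_{xy}$ with endpoints $x,y$ in $Q_n$ such that every vertex of $Q_n$ lies on exactly one of the two paths, and each of $e_1,e_2$ is an edge of one of them. -/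

import Mathlib

/-- The `n`-dimensional hypercube `Q_n`: the vertices are the `0/1`-words of length `n`, and two
vertices are adjacent if and only if they differ in exactly one coordinate. -/
def hypercube (n : ℕ) : SimpleGraph (Fin n → Bool) where
  Adj a b := (Finset.univ.filter (fun i => a i ≠ b i)).card = 1
  symm := ⟨fun a b h => by simpa only [ne_comm] using h⟩
  loopless := ⟨fun a h => by simp at h⟩

/-- The parity of a vertex of `Q_n`: the sum of its coordinates modulo `2`. -/
def parity {n : ℕ} (a : Fin n → Bool) : ℕ := (∑ i, (a i).toNat) % 2

/-- `P + Q` is a spanning `2`-path of `G`: the `u,v`-walk `P` and the `x,y`-walk `Q` are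
paths, they have no common vertex, and together they visit every vertex of `G`. -/
structure IsSpanningTwoPath {V : Type*} {G : SimpleGraph V} {u v x y : V}
    (P : G.Walk u v) (Q : G.Walk x y) : Prop where
  isPath_left : P.IsPath
  isPath_right : Q.IsPath
  disjoint : ∀ a : V, a ∈ P.support → a ∉ Q.support
  spanning : ∀ a : V, a ∈ P.support ∨ a ∈ Q.support

/-! The theorem is proved for all `n ≥ 4` by induction on the dimension, for a set `S` of at most
two edges. It is carried along with a statement on single paths, `HasPathsThroughPairs`: a
Hamiltonian path joins two vertices of different parity through all of `S`, provided that neither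
end meets two edges of `S` and that the ends are not themselves joined by an edge of `S`.

Inductive step: `S` has fewer edges than the cube has directions, so some direction `d` is used by
no edge of `S` (`exists_uncrossed`). Cutting along `d` gives two copies of `Q_m`, and each edge of
`S` lies in one of them. Paths in the two halves are combined in two ways. A path whose ends lie in
different halves crosses at a vertex `w` touched by no edge of `S` in either half
(`exists_untouched`), and the two pieces are joined by `exists_append_of_adj`. A half that still has
to be covered is absorbed by a detour: an edge `ac` of a path in the other half is replaced by a
path between the twins of `a` and `c` (`exists_splice`), where `ac` is not in `S` and the twins are
untouched by `S`. Counting shows that such `w` and `ac` exist once `m ≥ 4`. The distributions of the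
four ends over the halves reduce to five cases by symmetry.

Base case `n = 4`: translations and permutations of coordinates reduce the ends to a few
representatives. For each of these an explicit table of paths is checked by evaluation to cover
every allowed pair of edges. -/

namespace SimpleGraph.Walk

/-! ### Surgery on paths and counting their edges -/

variable {V : Type*} {G : SimpleGraph V}

/-- Two disjoint paths whose ends are joined by an edge can be concatenated. -/
theorem IsPath.exists_append_of_adj {u w w' v : V} {P : G.Walk u w} {Q : G.Walk w' v}
    (hP : P.IsPath) (hQ : Q.IsPath) (h : G.Adj w w') (hd : ∀ a ∈ P.support, a ∉ Q.support) :
    ∃ R : G.Walk u v, R.IsPath ∧ (∀ a, a ∈ R.support ↔ a ∈ P.support ∨ a ∈ Q.support) ∧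
      ∀ e, e ∈ P.edges ∨ e ∈ Q.edges → e ∈ R.edges := by
  refine ⟨P.append (cons h Q), ?_, ?_, ?_⟩
  · rw [isPath_def, support_append, List.nodup_append]
    refine ⟨hP.support_nodup, ?_, ?_⟩
    · simpa using hQ.support_nodup
    · rintro a ha b hb rfl
      exact hd a ha (by simpa using hb)
  · intro a
    rw [mem_support_append_iff, support_cons, List.mem_cons]
    constructor
    · rintro (h | rfl | h)
      · exact Or.inl h
      · exact Or.inl P.end_mem_support
      · exact Or.inr h
    · tauto
  · intro e he
    rw [edges_append, edges_cons, List.mem_append, List.mem_cons]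
    tauto

/-- An edge `ab` of a path can be replaced by a disjoint path whose ends are adjacent to `a`
and `b`. -/
theorem IsPath.exists_splice {u v : V} {P : G.Walk u v} (hP : P.IsPath) {a b a' b' : V}
    (hab : s(a, b) ∈ P.edges) {R : G.Walk a' b'} (hR : R.IsPath) (ha : G.Adj a a')
    (hb : G.Adj b b') (hd : ∀ c ∈ P.support, c ∉ R.support) :
    ∃ P' : G.Walk u v, P'.IsPath ∧ (∀ c, c ∈ P'.support ↔ c ∈ P.support ∨ c ∈ R.support) ∧
      ∀ e, (e ∈ P.edges ∧ e ≠ s(a, b)) ∨ e ∈ R.edges → e ∈ P'.edges := by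
  induction P with
  | nil => simp at hab
  | @cons u u₁ v h p ih =>
    rw [cons_isPath_iff] at hP
    have hdp : ∀ c ∈ p.support, c ∉ R.support := fun c hc => hd c (by simp [hc])
    have hdu : u ∉ R.support := hd u (by simp)
    -- The replaced edge is the first one of the walk. The claim is stated for arbitrary ends of the
    -- inserted path, so that it also applies to `R.reverse` when `s(a, b)` is traversed from `b` to
    -- `a`.
    have key : ∀ {a' b' : V} (R : G.Walk a' b'), R.IsPath → G.Adj u a' → G.Adj u₁ b' →
        (∀ c ∈ p.support, c ∉ R.support) → u ∉ R.support →
        ∃ P' : G.Walk u v, P'.IsPath ∧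
        (∀ c, c ∈ P'.support ↔ c ∈ (cons h p).support ∨ c ∈ R.support) ∧
        ∀ e, (e ∈ (cons h p).edges ∧ e ≠ s(u, u₁)) ∨ e ∈ R.edges → e ∈ P'.edges := by
      intro a' b' R hR ha hb hdp hdu
      obtain ⟨W, hW, hWs, hWe⟩ := hR.exists_append_of_adj hP.1 hb.symm
        (fun c hc hc' => hdp c hc' hc)
      refine ⟨cons ha W, ?_, ?_, ?_⟩
      · rw [cons_isPath_iff, hWs]
        exact ⟨hW, by tauto⟩
      · intro c
        simp only [support_cons, List.mem_cons, hWs]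
        tauto
      · intro e he
        simp only [edges_cons, List.mem_cons] at he ⊢
        have := hWe e
        tauto
    rw [edges_cons, List.mem_cons] at hab
    by_cases hh : s(a, b) = s(u, u₁)
    · rw [hh]
      rcases Sym2.eq_iff.1 hh with ⟨rfl, rfl⟩ | ⟨rfl, rfl⟩
      · exact key R hR ha hb hdp hdu
      · obtain ⟨P', h1, h2, h3⟩ := key R.reverse hR.reverse hb ha (by simpa using hdp)
          (by simpa using hdu)
        exact ⟨P', h1, by simpa using h2, by simpa using h3⟩
    · obtain ⟨P', h1, h2, h3⟩ := ih hP.1 (hab.resolve_left hh) hdp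
      refine ⟨cons h P', ?_, ?_, ?_⟩
      · rw [cons_isPath_iff, h2]
        exact ⟨h1, by tauto⟩
      · intro c
        simp only [support_cons, List.mem_cons, h2]
        tauto
      · intro e he
        simp only [edges_cons, List.mem_cons] at he ⊢
        have := h3 e
        tauto

variable [DecidableEq V]

theorem IsPath.card_filter_start_mem_edges_le {u v : V} {P : G.Walk u v} (hP : P.IsPath) :
    (P.edges.toFinset.filter (u ∈ ·)).card ≤ 1 := by
  cases P with
  | nil => simp
  | @cons _ w _ h p =>
    rw [cons_isPath_iff] at hP
    refine (Finset.card_le_card (t := {s(u, w)}) fun e he => ?_).trans (Finset.card_singleton _).le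
    simp only [edges_cons, Finset.mem_filter, List.mem_toFinset, List.mem_cons] at he
    rcases he with ⟨rfl | he, hu⟩
    · simp
    · exact absurd (p.mem_support_of_mem_edges he hu) hP.2

theorem IsPath.card_filter_mem_edges_le {u v : V} {P : G.Walk u v} (hP : P.IsPath) (c : V) :
    (P.edges.toFinset.filter (c ∈ ·)).card ≤ 2 := by
  induction P with
  | nil => simp
  | @cons u w v h p ih =>
    have hP' := cons_isPath_iff h p |>.1 hP
    by_cases hcu : c = u
    · subst hcu
      exact hP.card_filter_start_mem_edges_le.trans one_le_two
    · by_cases hcw : c = w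
      · subst hcw
        have := hP'.1.card_filter_start_mem_edges_le
        rw [edges_cons, List.toFinset_cons]
        refine (Finset.card_le_card (Finset.filter_insert _ _ _ |>.le.trans ?_)).trans
          (Finset.card_insert_le s(u, c) _ |>.trans (Nat.succ_le_succ this))
        split_ifs
        · rfl
        · exact Finset.subset_insert _ _
      · rw [edges_cons, List.toFinset_cons, Finset.filter_insert, if_neg]
        · exact ih hP'.1
        · simp [hcu, hcw]

theorem IsPath.card_edges_toFinset {u v : V} {P : G.Walk u v} (hP : P.IsPath) :
    P.edges.toFinset.card = P.length := by
  rw [List.toFinset_card_of_nodup hP.isTrail.edges_nodup, length_edges]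

/-- Each vertex of `B` rules out at most two edges of `E`, and `T` rules out at most `T.card` more.
Hence the bound `T.card + 2 * B.card`. -/
theorem exists_mem_edges_avoiding (E T : Finset (Sym2 V)) (B : Finset V)
    (hE : ∀ c, (E.filter (c ∈ ·)).card ≤ 2) (h : T.card + 2 * B.card < E.card) :
    ∃ a b, s(a, b) ∈ E ∧ s(a, b) ∉ T ∧ a ∉ B ∧ b ∉ B := by
  by_contra! hcon
  have hsub : E ⊆ T ∪ B.biUnion (fun c => E.filter (c ∈ ·)) := by
    intro e he
    induction e with | _ a b =>
    have := hcon a b he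
    simp only [Finset.mem_union, Finset.mem_biUnion, Finset.mem_filter]
    by_cases hT : s(a, b) ∈ T
    · exact Or.inl hT
    · by_cases ha : a ∈ B
      · exact Or.inr ⟨a, ha, he, by simp⟩
      · exact Or.inr ⟨b, this hT ha, he, by simp⟩
  have h1 := (Finset.card_le_card hsub).trans (Finset.card_union_le _ _)
  have h2 := Finset.card_biUnion_le_card_mul B _ 2 (fun c _ => hE c)
  omega

theorem IsPath.exists_edge_avoiding {u v : V} {P : G.Walk u v} (hP : P.IsPath)
    (T : Finset (Sym2 V)) (B : Finset V) (h : T.card + 2 * B.card < P.length) :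
    ∃ a b, s(a, b) ∈ P.edges ∧ s(a, b) ∉ T ∧ a ∉ B ∧ b ∉ B := by
  obtain ⟨a, b, hab, h'⟩ := exists_mem_edges_avoiding P.edges.toFinset T B
    hP.card_filter_mem_edges_le (by rwa [hP.card_edges_toFinset])
  exact ⟨a, b, by simpa using hab, h'⟩

theorem exists_edge_avoiding_of_disjoint {u v x y : V} {P : G.Walk u v} {Q : G.Walk x y}
    (hP : P.IsPath) (hQ : Q.IsPath) (hd : ∀ a, a ∈ P.support → a ∉ Q.support)
    (T : Finset (Sym2 V)) (B : Finset V) (h : T.card + 2 * B.card < P.length + Q.length) :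
    ∃ a b, (s(a, b) ∈ P.edges ∨ s(a, b) ∈ Q.edges) ∧ s(a, b) ∉ T ∧ a ∉ B ∧ b ∉ B := by
  have hdis : Disjoint P.edges.toFinset Q.edges.toFinset := by
    rw [Finset.disjoint_left]
    intro e
    induction e with | _ a b =>
    intro h1 h2
    rw [List.mem_toFinset] at h1 h2
    exact hd a (P.fst_mem_support_of_mem_edges h1) (Q.fst_mem_support_of_mem_edges h2)
  obtain ⟨a, b, hab, h'⟩ := exists_mem_edges_avoiding (P.edges.toFinset ∪ Q.edges.toFinset) T B
    (fun c => by
      rw [Finset.filter_union]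
      by_cases hc : c ∈ P.support
      · rw [Finset.filter_eq_empty_iff (s := Q.edges.toFinset) |>.2, Finset.union_empty]
        · exact hP.card_filter_mem_edges_le c
        · intro e he hce
          exact hd c hc (Q.mem_support_of_mem_edges (List.mem_toFinset.1 he) hce)
      · rw [Finset.filter_eq_empty_iff (s := P.edges.toFinset) |>.2, Finset.empty_union]
        · exact hQ.card_filter_mem_edges_le c
        · intro e he hce
          exact hc (P.mem_support_of_mem_edges (List.mem_toFinset.1 he) hce))
    (by rwa [Finset.card_union_of_disjoint hdis, hP.card_edges_toFinset, hQ.card_edges_toFinset])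
  exact ⟨a, b, by simpa using hab, h'⟩

theorem IsPath.length_of_spanning [Fintype V] {u v : V} {P : G.Walk u v} (hP : P.IsPath)
    (h : ∀ a, a ∈ P.support) : P.length + 1 = Fintype.card V := by
  rw [← length_support, ← List.toFinset_card_of_nodup hP.support_nodup, ← Finset.card_univ]
  congr 1
  ext a
  simp [h a]

end SimpleGraph.Walk

theorem IsSpanningTwoPath.length_add_length {V : Type*} [Fintype V] [DecidableEq V]
    {G : SimpleGraph V} {u v x y : V} {P : G.Walk u v} {Q : G.Walk x y}
    (h : IsSpanningTwoPath P Q) : P.length + Q.length + 2 = Fintype.card V := by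
  have h1 := P.length_support
  have h2 := Q.length_support
  rw [← List.toFinset_card_of_nodup h.isPath_left.support_nodup] at h1
  rw [← List.toFinset_card_of_nodup h.isPath_right.support_nodup] at h2
  have h3 : (P.support.toFinset ∪ Q.support.toFinset).card = _ :=
    Finset.card_union_of_disjoint (by
      rw [Finset.disjoint_left]
      intro a ha hb
      exact h.disjoint a (by simpa using ha) (by simpa using hb))
  have h4 : P.support.toFinset ∪ Q.support.toFinset = Finset.univ := by
    ext a
    simpa using h.spanning a
  rw [h4, Finset.card_univ] at h3
  omega

/-! ### Vertices met by the prescribed edges -/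

/-- The vertices of `Q_n` on which an edge of `S` ends. -/
def touched {V : Type*} [DecidableEq V] (S : Finset (Sym2 V)) : Finset V :=
  S.biUnion Sym2.toFinset

section touched

variable {V : Type*} [DecidableEq V] {S : Finset (Sym2 V)}

theorem mem_touched {a : V} : a ∈ touched S ↔ ∃ e ∈ S, a ∈ e := by
  simp [touched]

theorem card_touched_le : (touched S).card ≤ 2 * S.card := by
  rw [mul_comm]
  refine Finset.card_biUnion_le_card_mul S _ 2 fun e _ => ?_
  have := Sym2.card_toFinset e
  split_ifs at this <;> omega

theorem notMem_of_notMem_touched {a : V} (h : a ∉ touched S) {e : Sym2 V} (he : e ∈ S) :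
    a ∉ e := fun ha => h (mem_touched.2 ⟨e, he, ha⟩)

/-- No two edges of `S` end on `a`. -/
def TouchedOnce (S : Finset (Sym2 V)) (a : V) : Prop :=
  ∀ e ∈ S, ∀ f ∈ S, a ∈ e → a ∈ f → e = f

theorem touchedOnce_of_notMem_touched {a : V} (h : a ∉ touched S) : TouchedOnce S a :=
  fun _ he _ _ ha _ => absurd ha (notMem_of_notMem_touched h he)

end touched

theorem parity_lt_two {n : ℕ} (a : Fin n → Bool) : parity a < 2 := Nat.mod_lt _ two_pos

/-- With a sum in place of a cardinality, `Fin.sum_univ_succAbove` splits off the coordinate along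
which the cube is cut. -/
theorem hypercube_adj_iff {n : ℕ} {a b : Fin n → Bool} :
    (hypercube n).Adj a b ↔ ∑ i, (if a i ≠ b i then 1 else 0) = 1 := by
  rw [← Finset.card_filter]
  rfl

theorem parity_ne_of_adj {n : ℕ} {a b : Fin n → Bool} (h : (hypercube n).Adj a b) :
    parity a ≠ parity b := by
  rw [hypercube_adj_iff] at h
  -- Modulo 2, `a i + b i` indicates whether `a` and `b` differ at `i`.
  have key : (∑ i, (a i).toNat + ∑ i, (b i).toNat) % 2 =
      (∑ i, (if a i ≠ b i then 1 else 0)) % 2 := by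
    rw [← Finset.sum_add_distrib, Finset.sum_nat_mod]
    congr 1
    refine Finset.sum_congr rfl fun i _ => ?_
    cases a i <;> cases b i <;> rfl
  rw [h] at key
  unfold parity
  omega

/-! ### The two halves of a cube -/

section halves

variable {m : ℕ}

/-- The half of `Q_{m+1}` in which the coordinate `d` has the value `b`, as a copy of `Q_m`. -/
def half (d : Fin (m + 1)) (b : Bool) (w : Fin m → Bool) : Fin (m + 1) → Bool :=
  d.insertNth b w

variable {d : Fin (m + 1)} {b : Bool} {w w' : Fin m → Bool}

@[simp] theorem half_apply_same : half d b w d = b := by simp [half]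

@[simp] theorem half_apply_succAbove {i : Fin m} : half d b w (d.succAbove i) = w i := by
  simp [half]

theorem half_injective : Function.Injective (half d b) := fun w w' h => by
  funext i
  simpa using congrFun h (d.succAbove i)

@[simp] theorem half_inj : half d b w = half d b w' ↔ w = w' := half_injective.eq_iff

@[simp] theorem half_ne_half_not : half d b w ≠ half d (!b) w' := fun h => by
  simpa using congrFun h d

@[simp] theorem half_not_ne_half : half d (!b) w ≠ half d b w' := fun h => by
  simpa using congrFun h d

theorem exists_eq_half_of_apply {a : Fin (m + 1) → Bool} (h : a d = b) : ∃ w, a = half d b w :=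
  ⟨d.removeNth a, by subst h; simp [half]⟩

theorem exists_eq_half (d : Fin (m + 1)) (b : Bool) (a : Fin (m + 1) → Bool) :
    (∃ w, a = half d b w) ∨ ∃ w, a = half d (!b) w := by
  rcases Bool.eq_or_eq_not (a d) b with h | h
  · exact Or.inl (exists_eq_half_of_apply h)
  · exact Or.inr (exists_eq_half_of_apply h)

theorem half_adj_half : (hypercube (m + 1)).Adj (half d b w) (half d b w') ↔
    (hypercube m).Adj w w' := by
  simp [hypercube_adj_iff, Fin.sum_univ_succAbove _ d]

theorem half_adj_half_not : (hypercube (m + 1)).Adj (half d b w) (half d (!b) w) := by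
  simp [hypercube_adj_iff, Fin.sum_univ_succAbove _ d]

theorem parity_half : parity (half d b w) = (b.toNat + parity w) % 2 := by
  simp [parity, Fin.sum_univ_succAbove _ d]

theorem parity_half_ne_iff : parity (half d b w) ≠ parity (half d b w') ↔
    parity w ≠ parity w' := by
  have := parity_lt_two w
  have := parity_lt_two w'
  rw [parity_half, parity_half]
  omega

theorem parity_half_ne_half_not_iff : parity (half d b w) ≠ parity (half d (!b) w') ↔
    parity w = parity w' := by
  have := parity_lt_two w
  have := parity_lt_two w'
  rw [parity_half, parity_half]
  cases b <;> simp <;> omega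

/-- The inclusion of a half as a graph homomorphism. -/
def halfHom (d : Fin (m + 1)) (b : Bool) : hypercube m →g hypercube (m + 1) where
  toFun := half d b
  map_rel' := half_adj_half.2

/-- The copy in `Q_{m+1}` of a walk in one of its halves. -/
def halfWalk (d : Fin (m + 1)) (b : Bool) {u v : Fin m → Bool} (P : (hypercube m).Walk u v) :
    (hypercube (m + 1)).Walk (half d b u) (half d b v) :=
  P.map (halfHom d b)

variable {u v : Fin m → Bool} {P : (hypercube m).Walk u v}

theorem isPath_halfWalk (hP : P.IsPath) : (halfWalk d b P).IsPath :=
  hP.map half_injective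

theorem support_halfWalk : (halfWalk d b P).support = P.support.map (half d b) :=
  SimpleGraph.Walk.support_map _ _

theorem edges_halfWalk : (halfWalk d b P).edges = P.edges.map (Sym2.map (half d b)) :=
  SimpleGraph.Walk.edges_map _ _

@[simp] theorem half_mem_support_halfWalk :
    half d b w ∈ (halfWalk d b P).support ↔ w ∈ P.support := by
  simp [support_halfWalk]

@[simp] theorem half_not_notMem_support_halfWalk :
    half d (!b) w ∉ (halfWalk d b P).support := by
  simp [support_halfWalk, half_ne_half_not]

@[simp] theorem half_notMem_support_halfWalk_not :
    half d b w ∉ (halfWalk d (!b) P).support := by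
  simp [support_halfWalk, half_not_ne_half]

theorem map_half_injective : Function.Injective (Sym2.map (half d b)) :=
  Sym2.map.injective half_injective

theorem map_half_eq_iff {e : Sym2 (Fin m → Bool)} {a c : Fin m → Bool} :
    Sym2.map (half d b) e = s(half d b a, half d b c) ↔ e = s(a, c) :=
  map_half_injective.eq_iff (b := s(a, c))

@[simp] theorem map_half_mem_edges_halfWalk {e : Sym2 (Fin m → Bool)} :
    Sym2.map (half d b) e ∈ (halfWalk d b P).edges ↔ e ∈ P.edges := by
  rw [edges_halfWalk, List.mem_map_of_injective map_half_injective]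

theorem forall_mem_support_halfWalk_notMem {x y : Fin m → Bool} {Q : (hypercube m).Walk x y} :
    ∀ a ∈ (halfWalk d b P).support, a ∉ (halfWalk d (!b) Q).support := by
  intro a ha
  rw [support_halfWalk, List.mem_map] at ha
  obtain ⟨w, -, rfl⟩ := ha
  simp

/-- The edges of `S` that lie in one half, as edges of `Q_m`. -/
noncomputable def restrictEdges (d : Fin (m + 1)) (b : Bool)
    (S : Finset (Sym2 (Fin (m + 1) → Bool))) : Finset (Sym2 (Fin m → Bool)) :=
  S.preimage (Sym2.map (half d b)) map_half_injective.injOn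

variable {S : Finset (Sym2 (Fin (m + 1) → Bool))} {e : Sym2 (Fin m → Bool)}

theorem mem_restrictEdges : e ∈ restrictEdges d b S ↔ Sym2.map (half d b) e ∈ S :=
  Finset.mem_preimage

theorem map_half_ne_map_half_not {e f : Sym2 (Fin m → Bool)} :
    Sym2.map (half d b) e ≠ Sym2.map (half d (!b)) f := by
  induction e with | _ a c =>
  intro h
  have : half d b a ∈ Sym2.map (half d (!b)) f := by
    rw [← h]
    simp
  obtain ⟨w, -, hw⟩ := Sym2.mem_map.1 this
  exact half_not_ne_half hw

/-- The images of the two restrictions are disjoint subsets of `S`. Only an inequality holds in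
general, since edges in direction `d` lie in neither half. -/
theorem card_restrictEdges_add_le (d : Fin (m + 1)) (b : Bool)
    (S : Finset (Sym2 (Fin (m + 1) → Bool))) :
    (restrictEdges d b S).card + (restrictEdges d (!b) S).card ≤ S.card := by
  classical
  rw [← Finset.card_image_of_injective (restrictEdges d b S) (map_half_injective (d := d) (b := b)),
    ← Finset.card_image_of_injective (restrictEdges d (!b) S)
      (map_half_injective (d := d) (b := !b)), ← Finset.card_union_of_disjoint]
  · refine Finset.card_le_card fun e he => ?_
    simp only [Finset.mem_union, Finset.mem_image, mem_restrictEdges] at he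
    rcases he with ⟨f, hf, rfl⟩ | ⟨f, hf, rfl⟩ <;> exact hf
  · rw [Finset.disjoint_left]
    intro e he he'
    simp only [Finset.mem_image] at he he'
    obtain ⟨f, -, rfl⟩ := he
    obtain ⟨g, -, hg⟩ := he'
    exact map_half_ne_map_half_not hg.symm

theorem restrictEdges_subset_edgeSet (hS : ∀ e ∈ S, e ∈ (hypercube (m + 1)).edgeSet) :
    ∀ e ∈ restrictEdges d b S, e ∈ (hypercube m).edgeSet := by
  intro e he
  have := hS _ (mem_restrictEdges.1 he)
  induction e with | _ a c =>
  exact half_adj_half.1 this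

theorem TouchedOnce.restrictEdges (h : TouchedOnce S (half d b w)) :
    TouchedOnce (restrictEdges d b S) w := fun _ he _ hf hwe hwf =>
  map_half_injective (h _ (mem_restrictEdges.1 he) _ (mem_restrictEdges.1 hf)
    (Sym2.mem_map.2 ⟨w, hwe, rfl⟩) (Sym2.mem_map.2 ⟨w, hwf, rfl⟩))

theorem forall_mem_restrictEdges_notMem (h : ∀ e ∈ S, half d b w ∉ e) :
    ∀ e ∈ restrictEdges d b S, w ∉ e := fun _ he hw =>
  h _ (mem_restrictEdges.1 he) (Sym2.mem_map.2 ⟨w, hw, rfl⟩)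

/-- No edge of `S` changes the coordinate `d`. -/
def Uncrossed (d : Fin m) (S : Finset (Sym2 (Fin m → Bool))) : Prop :=
  ∀ e ∈ S, ∀ a ∈ e, ∀ c ∈ e, a d = c d

theorem Uncrossed.exists_map_half (h : Uncrossed d S) (b : Bool)
    {e : Sym2 (Fin (m + 1) → Bool)} (he : e ∈ S) :
    (∃ f ∈ _root_.restrictEdges d b S, e = Sym2.map (half d b) f) ∨
      ∃ f ∈ _root_.restrictEdges d (!b) S, e = Sym2.map (half d (!b)) f := by
  induction e with | _ p q =>
  have hpq : p d = q d := h _ he p (by simp) q (by simp)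
  rcases Bool.eq_or_eq_not (p d) b with hp | hp
  · obtain ⟨w, rfl⟩ := exists_eq_half_of_apply hp
    obtain ⟨w', rfl⟩ := exists_eq_half_of_apply (hpq ▸ hp)
    exact Or.inl ⟨s(w, w'), mem_restrictEdges.2 he, rfl⟩
  · obtain ⟨w, rfl⟩ := exists_eq_half_of_apply hp
    obtain ⟨w', rfl⟩ := exists_eq_half_of_apply (hpq ▸ hp)
    exact Or.inr ⟨s(w, w'), mem_restrictEdges.2 he, rfl⟩

/-- An edge changes exactly one coordinate, so fewer than `n` edges leave some coordinate unchanged.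
-/
theorem exists_uncrossed {n : ℕ} (S : Finset (Sym2 (Fin n → Bool)))
    (hS : ∀ e ∈ S, e ∈ (hypercube n).edgeSet) (hc : S.card < n) : ∃ d, Uncrossed d S := by
  classical
  have key : ∀ e ∈ S, ∃ i : Fin n, ∀ j ≠ i, ∀ a ∈ e, ∀ c ∈ e, a j = c j := by
    intro e he
    have := hS e he
    induction e with | _ p q =>
    obtain ⟨i, hi⟩ := Finset.card_eq_one.1 (show (Finset.univ.filter fun i => p i ≠ q i).card = 1
      from this)
    refine ⟨i, fun j hj => ?_⟩
    have : p j = q j := by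
      by_contra hne
      have : j ∈ Finset.univ.filter fun i => p i ≠ q i := by simp [hne]
      rw [hi] at this
      exact hj (by simpa using this)
    simp [this]
  have : Nonempty (Fin n) := ⟨⟨0, by omega⟩⟩
  choose! f hf using key
  obtain ⟨d, -, hd⟩ := Finset.exists_mem_notMem_of_card_lt_card
    (s := S.image f) (t := Finset.univ)
    (Finset.card_image_le.trans_lt (by simpa using hc))
  refine ⟨d, fun e he => hf e he d ?_⟩
  rintro rfl
  exact hd (Finset.mem_image_of_mem f he)

/-- Each parity class of `Q_m` has `2 ^ (m - 1) ≥ 8` vertices, which is one more than `B` can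
exclude. -/
theorem exists_parity_eq_notMem {m : ℕ} (hm : 4 ≤ m) (B : Finset (Fin m → Bool))
    (hB : B.card ≤ 7) {q : ℕ} (hq : q < 2) : ∃ w, parity w = q ∧ w ∉ B := by
  classical
  obtain ⟨k, rfl⟩ : ∃ k, m = k + 1 := ⟨m - 1, by omega⟩
  -- The other coordinates are free, and coordinate `0` corrects the parity to `q`.
  let f : (Fin k → Bool) → (Fin (k + 1) → Bool) := fun w => half 0 (decide (parity w ≠ q)) w
  have hf : Function.Injective f := fun w w' h => by
    funext i
    simpa only [f, half_apply_succAbove] using congrFun h ((0 : Fin (k + 1)).succAbove i)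
  have hpar : ∀ w, parity (f w) = q := fun w => by
    have := parity_lt_two w
    simp only [f, parity_half]
    by_cases hw : parity w = q
    · simp [hw]
      omega
    · simp [hw]
      omega
  obtain ⟨w, hw, hwB⟩ := Finset.exists_mem_notMem_of_card_lt_card (s := B)
    (t := Finset.univ.image f) (by
      rw [Finset.card_image_of_injective _ hf]
      simp only [Finset.card_univ, Fintype.card_fun, Fintype.card_bool, Fintype.card_fin]
      have : 2 ^ 3 ≤ 2 ^ k := Nat.pow_le_pow_right two_pos (by omega)
      omega)
  obtain ⟨w, -, rfl⟩ := Finset.mem_image.1 hw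
  exact ⟨f w, hpar w, hwB⟩

end halves

/-! ### The two statements proved by induction -/

/-- Between any two vertices of `Q_n` of different parity there is a Hamiltonian path through a
given set of at most two edges, unless it obviously cannot exist. -/
def HasPathsThroughPairs (n : ℕ) : Prop :=
  ∀ (S : Finset (Sym2 (Fin n → Bool))) (u v : Fin n → Bool), S.card ≤ 2 →
    (∀ e ∈ S, e ∈ (hypercube n).edgeSet) → parity u ≠ parity v → s(u, v) ∉ S →
    TouchedOnce S u → TouchedOnce S v →
    ∃ P : (hypercube n).Walk u v, P.IsPath ∧ (∀ a, a ∈ P.support) ∧ ∀ e ∈ S, e ∈ P.edges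

/-- The hypotheses under which a spanning `2`-path through the edges in `S` is sought. -/
structure Admissible {n : ℕ} (S : Finset (Sym2 (Fin n → Bool))) (u v x y : Fin n → Bool) :
    Prop where
  card_le : S.card ≤ 2
  mem_edgeSet : ∀ e ∈ S, e ∈ (hypercube n).edgeSet
  parity_left : parity u ≠ parity v
  parity_right : parity x ≠ parity y
  ux : u ≠ x
  uy : u ≠ y
  vx : v ≠ x
  vy : v ≠ y
  notMem_x : ∀ e ∈ S, x ∉ e
  notMem_y : ∀ e ∈ S, y ∉ e
  once_u : TouchedOnce S u
  once_v : TouchedOnce S v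

/-- There is a spanning `2`-path `P_{uv} + P_{xy}` through all edges in `S`. -/
def Linked {V : Type*} (G : SimpleGraph V) (S : Finset (Sym2 V)) (u v x y : V) : Prop :=
  ∃ (P : G.Walk u v) (Q : G.Walk x y), IsSpanningTwoPath P Q ∧
    ∀ e ∈ S, e ∈ P.edges ∨ e ∈ Q.edges

/-- Every admissible choice of ends and of at most two edges admits a spanning `2`-path. -/
def HasTwoPathsThroughPairs (n : ℕ) : Prop :=
  ∀ (S : Finset (Sym2 (Fin n → Bool))) (u v x y : Fin n → Bool),
    Admissible S u v x y → Linked (hypercube n) S u v x y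

theorem Admissible.swap_left {n : ℕ} {S : Finset (Sym2 (Fin n → Bool))} {u v x y : Fin n → Bool}
    (h : Admissible S u v x y) : Admissible S v u x y :=
  ⟨h.card_le, h.mem_edgeSet, h.parity_left.symm, h.parity_right, h.vx, h.vy, h.ux, h.uy,
    h.notMem_x, h.notMem_y, h.once_v, h.once_u⟩

theorem Admissible.swap_right {n : ℕ} {S : Finset (Sym2 (Fin n → Bool))} {u v x y : Fin n → Bool}
    (h : Admissible S u v x y) : Admissible S u v y x :=
  ⟨h.card_le, h.mem_edgeSet, h.parity_left, h.parity_right.symm, h.uy, h.ux, h.vy, h.vx,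
    h.notMem_y, h.notMem_x, h.once_u, h.once_v⟩

theorem Linked.swap_left {V : Type*} {G : SimpleGraph V} {S : Finset (Sym2 V)} {u v x y : V}
    (h : Linked G S u v x y) : Linked G S v u x y := by
  obtain ⟨P, Q, hPQ, hS⟩ := h
  exact ⟨P.reverse, Q, ⟨hPQ.isPath_left.reverse, hPQ.isPath_right, by simpa using hPQ.disjoint,
    by simpa using hPQ.spanning⟩, by simpa using hS⟩

theorem Linked.swap_right {V : Type*} {G : SimpleGraph V} {S : Finset (Sym2 V)} {u v x y : V}
    (h : Linked G S u v x y) : Linked G S u v y x := by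
  obtain ⟨P, Q, hPQ, hS⟩ := h
  exact ⟨P, Q.reverse, ⟨hPQ.isPath_left, hPQ.isPath_right.reverse, by simpa using hPQ.disjoint,
    by simpa using hPQ.spanning⟩, by simpa using hS⟩

/-! ### The inductive step -/

section step

variable {m : ℕ} {S : Finset (Sym2 (Fin (m + 1) → Bool))} {d : Fin (m + 1)} {b : Bool}

/-- When one end is chosen off all prescribed edges, the edge `wv` cannot be prescribed and the
condition at `w` is vacuous. -/
theorem HasPathsThroughPairs.of_notMem_touched {m : ℕ} (hE : HasPathsThroughPairs m)
    {S : Finset (Sym2 (Fin m → Bool))} {w v : Fin m → Bool} (hc : S.card ≤ 2)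
    (hS : ∀ e ∈ S, e ∈ (hypercube m).edgeSet) (hp : parity w ≠ parity v) (hw : w ∉ touched S)
    (hv : TouchedOnce S v) :
    ∃ P : (hypercube m).Walk w v, P.IsPath ∧ (∀ a, a ∈ P.support) ∧ ∀ e ∈ S, e ∈ P.edges :=
  hE S w v hc hS hp (fun h => notMem_of_notMem_touched hw h (by simp))
    (touchedOnce_of_notMem_touched hw) hv

/-- Supplies the places where a path crosses between the halves. The edges of `S` touch at most four
vertices in both halves together; with the three of `B` this makes the seven allowed by
`exists_parity_eq_notMem`. -/
theorem exists_untouched (hm : 4 ≤ m) (hc : S.card ≤ 2) (d : Fin (m + 1)) (b : Bool)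
    (w₀ : Fin m → Bool) (B : Finset (Fin m → Bool)) (hB : B.card ≤ 3) :
    ∃ w, parity w ≠ parity w₀ ∧ w ∉ B ∧ w ∉ touched (restrictEdges d b S) ∧
      w ∉ touched (restrictEdges d (!b) S) := by
  have h1 := card_restrictEdges_add_le d b S
  have h2 := card_touched_le (S := restrictEdges d b S)
  have h3 := card_touched_le (S := restrictEdges d (!b) S)
  obtain ⟨w, hw, hwB⟩ := exists_parity_eq_notMem hm
    (B ∪ (touched (restrictEdges d b S) ∪ touched (restrictEdges d (!b) S)))
    ((Finset.card_union_le _ _).trans (by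
      have := Finset.card_union_le (touched (restrictEdges d b S))
        (touched (restrictEdges d (!b) S))
      omega)) (q := 1 - parity w₀) (by omega)
  have := parity_lt_two w₀
  simp only [Finset.mem_union, not_or] at hwB
  exact ⟨w, by omega, hwB⟩

theorem Uncrossed.forall_mem {p : Sym2 (Fin (m + 1) → Bool) → Prop} (hd : Uncrossed d S) (b : Bool)
    (h₀ : ∀ f ∈ restrictEdges d b S, p (Sym2.map (half d b) f))
    (h₁ : ∀ f ∈ restrictEdges d (!b) S, p (Sym2.map (half d (!b)) f)) : ∀ e ∈ S, p e := by
  intro e he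
  rcases hd.exists_map_half b he with ⟨f, hf, rfl⟩ | ⟨f, hf, rfl⟩
  · exact h₀ f hf
  · exact h₁ f hf

theorem sixteen_le_card_vertices (hm : 4 ≤ m) : 16 ≤ Fintype.card (Fin m → Bool) := by
  rw [Fintype.card_fun, Fintype.card_bool, Fintype.card_fin]
  exact Nat.pow_le_pow_right (n := 2) (i := 4) two_pos hm

/-- The path crosses at an untouched `w` of the other parity than `u`. Since `u` and `v` have equal
parity within their halves, `w` can be joined to both. -/
theorem exists_hamiltonian_of_split (hm : 4 ≤ m) (hE : HasPathsThroughPairs m)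
    (hc : S.card ≤ 2) (hS : ∀ e ∈ S, e ∈ (hypercube (m + 1)).edgeSet) (hd : Uncrossed d S)
    {u v : Fin m → Bool} (hp : parity u = parity v) (hu : TouchedOnce S (half d b u))
    (hv : TouchedOnce S (half d (!b) v)) :
    ∃ P : (hypercube (m + 1)).Walk (half d b u) (half d (!b) v), P.IsPath ∧
      (∀ a, a ∈ P.support) ∧ ∀ e ∈ S, e ∈ P.edges := by
  have hc' := card_restrictEdges_add_le d b S
  obtain ⟨w, hw, -, hw₀, hw₁⟩ := exists_untouched hm hc d b u ∅ (by simp)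
  obtain ⟨P, hP, hPs, hPe⟩ := hE.of_notMem_touched (by omega) (restrictEdges_subset_edgeSet hS)
    hw hw₀ hu.restrictEdges
  obtain ⟨Q, hQ, hQs, hQe⟩ := hE.of_notMem_touched (by omega) (restrictEdges_subset_edgeSet hS)
    (hp ▸ hw) hw₁ hv.restrictEdges
  obtain ⟨R, hR, hRs, hRe⟩ := (isPath_halfWalk (d := d) (b := b) hP.reverse).exists_append_of_adj
    (isPath_halfWalk hQ) half_adj_half_not forall_mem_support_halfWalk_notMem
  refine ⟨R, hR, fun a => (hRs a).2 ?_, hd.forall_mem b ?_ ?_⟩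
  · rcases exists_eq_half d b a with ⟨w, rfl⟩ | ⟨w, rfl⟩ <;> simp [hPs, hQs]
  · exact fun f hf => hRe _ (Or.inl (by simpa using hPe f hf))
  · exact fun f hf => hRe _ (Or.inr (by simpa using hQe f hf))

/-- A Hamiltonian path of the half containing both ends makes a detour through the whole other half.
-/
theorem exists_hamiltonian_of_same (hm : 4 ≤ m) (hE : HasPathsThroughPairs m)
    (hc : S.card ≤ 2) (hS : ∀ e ∈ S, e ∈ (hypercube (m + 1)).edgeSet) (hd : Uncrossed d S)
    {u v : Fin m → Bool} (hp : parity u ≠ parity v) (huv : s(half d b u, half d b v) ∉ S)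
    (hu : TouchedOnce S (half d b u)) (hv : TouchedOnce S (half d b v)) :
    ∃ P : (hypercube (m + 1)).Walk (half d b u) (half d b v), P.IsPath ∧
      (∀ a, a ∈ P.support) ∧ ∀ e ∈ S, e ∈ P.edges := by
  have hc' := card_restrictEdges_add_le d b S
  have hB := card_touched_le (S := restrictEdges d (!b) S)
  obtain ⟨P, hP, hPs, hPe⟩ := hE (restrictEdges d b S) u v (by omega)
    (restrictEdges_subset_edgeSet hS) hp (fun h => huv (mem_restrictEdges.1 h))
    hu.restrictEdges hv.restrictEdges
  have hl := hP.length_of_spanning hPs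
  have hm' := sixteen_le_card_vertices hm
  -- At most `2 * 4 = 8` edges are excluded, while the path has at least 15.
  obtain ⟨a, c, hac, hacS, ha, hc⟩ := hP.exists_edge_avoiding (restrictEdges d b S)
    (touched (restrictEdges d (!b) S)) (by omega)
  obtain ⟨R, hR, hRs, hRe⟩ := hE.of_notMem_touched (by omega) (restrictEdges_subset_edgeSet hS)
    (parity_ne_of_adj (P.adj_of_mem_edges hac)) ha (touchedOnce_of_notMem_touched hc)
  obtain ⟨P', hP', hPs', hPe'⟩ := (isPath_halfWalk (d := d) (b := b) hP).exists_splice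
    (map_half_mem_edges_halfWalk.2 hac) (isPath_halfWalk (b := !b) hR) half_adj_half_not
    half_adj_half_not forall_mem_support_halfWalk_notMem
  refine ⟨P', hP', fun a => (hPs' a).2 ?_, hd.forall_mem b ?_ ?_⟩
  · rcases exists_eq_half d b a with ⟨w, rfl⟩ | ⟨w, rfl⟩ <;> simp [hPs, hRs]
  · refine fun f hf => hPe' _ (Or.inl ⟨by simpa using hPe f hf, ?_⟩)
    exact fun h => hacS (map_half_eq_iff.1 h ▸ hf)
  · exact fun f hf => hPe' _ (Or.inr (by simpa using hRe f hf))

theorem HasPathsThroughPairs.succ (hm : 4 ≤ m) (hE : HasPathsThroughPairs m) :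
    HasPathsThroughPairs (m + 1) := by
  intro S u v hc hS hp huv hu hv
  obtain ⟨d, hd⟩ := exists_uncrossed S hS (by omega)
  obtain ⟨b, hb⟩ : ∃ b, u d = b := ⟨_, rfl⟩
  obtain ⟨u, rfl⟩ := exists_eq_half_of_apply hb
  rcases exists_eq_half d b v with ⟨v, rfl⟩ | ⟨v, rfl⟩
  · exact exists_hamiltonian_of_same hm hE hc hS hd (parity_half_ne_iff.1 hp) huv hu hv
  · exact exists_hamiltonian_of_split hm hE hc hS hd (parity_half_ne_half_not_iff.1 hp) hu hv

variable {u v x y : Fin m → Bool}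

/-- The inductive 2-path of the half with all four ends makes a detour through the other half, on
whichever of its two paths has a suitable edge. The two paths have at least 14 edges together, and
at most 8 are excluded. -/
theorem linked_of_same_half (hm : 4 ≤ m) (hE : HasPathsThroughPairs m)
    (hF : HasTwoPathsThroughPairs m) (hd : Uncrossed d S)
    (h : Admissible S (half d b u) (half d b v) (half d b x) (half d b y)) :
    Linked (hypercube (m + 1)) S (half d b u) (half d b v) (half d b x) (half d b y) := by
  have hc := h.card_le
  have hc' := card_restrictEdges_add_le d b S
  have hB := card_touched_le (S := restrictEdges d (!b) S)
  obtain ⟨P, Q, hPQ, hPQe⟩ := hF (restrictEdges d b S) u v x y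
    { card_le := by omega
      mem_edgeSet := restrictEdges_subset_edgeSet h.mem_edgeSet
      parity_left := parity_half_ne_iff.1 h.parity_left
      parity_right := parity_half_ne_iff.1 h.parity_right
      ux := by simpa using h.ux
      uy := by simpa using h.uy
      vx := by simpa using h.vx
      vy := by simpa using h.vy
      notMem_x := forall_mem_restrictEdges_notMem h.notMem_x
      notMem_y := forall_mem_restrictEdges_notMem h.notMem_y
      once_u := h.once_u.restrictEdges
      once_v := h.once_v.restrictEdges }
  have hl := hPQ.length_add_length
  have hm' := sixteen_le_card_vertices hm
  obtain ⟨a, c, hac, hacS, ha, hc⟩ := SimpleGraph.Walk.exists_edge_avoiding_of_disjoint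
    hPQ.isPath_left hPQ.isPath_right hPQ.disjoint (restrictEdges d b S)
    (touched (restrictEdges d (!b) S)) (by omega)
  have hadj : (hypercube m).Adj a c := hac.elim P.adj_of_mem_edges Q.adj_of_mem_edges
  obtain ⟨R, hR, hRs, hRe⟩ := hE.of_notMem_touched (by omega)
    (restrictEdges_subset_edgeSet h.mem_edgeSet) (parity_ne_of_adj hadj) ha
    (touchedOnce_of_notMem_touched hc)
  have hne : ∀ f ∈ restrictEdges d b S, Sym2.map (half d b) f ≠ s(half d b a, half d b c) :=
    fun f hf h => hacS (map_half_eq_iff.1 h ▸ hf)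
  rcases hac with hac | hac
  · obtain ⟨P', hP', hPs', hPe'⟩ := (isPath_halfWalk (d := d) (b := b)
      hPQ.isPath_left).exists_splice
      (map_half_mem_edges_halfWalk.2 hac) (isPath_halfWalk (b := !b) hR) half_adj_half_not
      half_adj_half_not forall_mem_support_halfWalk_notMem
    refine ⟨P', halfWalk d b Q, ⟨hP', isPath_halfWalk hPQ.isPath_right, fun a ha => ?_,
      fun a => ?_⟩, hd.forall_mem b ?_ ?_⟩
    · rw [hPs'] at ha
      rcases exists_eq_half d b a with ⟨w, rfl⟩ | ⟨w, rfl⟩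
      · simpa using hPQ.disjoint w (by simpa using ha)
      · simp
    · rw [hPs']
      rcases exists_eq_half d b a with ⟨w, rfl⟩ | ⟨w, rfl⟩
      · simpa using hPQ.spanning w
      · simp [hRs]
    · exact fun f hf => (hPQe f hf).imp
        (fun h => hPe' _ (Or.inl ⟨by simpa using h, hne f hf⟩)) (fun h => by simpa using h)
    · exact fun f hf => Or.inl (hPe' _ (Or.inr (by simpa using hRe f hf)))
  · obtain ⟨Q', hQ', hQs', hQe'⟩ := (isPath_halfWalk (d := d) (b := b)
      hPQ.isPath_right).exists_splice
      (map_half_mem_edges_halfWalk.2 hac) (isPath_halfWalk (b := !b) hR) half_adj_half_not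
      half_adj_half_not forall_mem_support_halfWalk_notMem
    refine ⟨halfWalk d b P, Q', ⟨isPath_halfWalk hPQ.isPath_left, hQ', fun a ha => ?_,
      fun a => ?_⟩, hd.forall_mem b ?_ ?_⟩
    · rw [hQs']
      rcases exists_eq_half d b a with ⟨w, rfl⟩ | ⟨w, rfl⟩
      · simpa using hPQ.disjoint w (by simpa using ha)
      · simp at ha
    · rw [hQs']
      rcases exists_eq_half d b a with ⟨w, rfl⟩ | ⟨w, rfl⟩
      · simpa using hPQ.spanning w
      · simp [hRs]
    · exact fun f hf => (hPQe f hf).imp (fun h => by simpa using h)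
        (fun h => hQe' _ (Or.inl ⟨by simpa using h, hne f hf⟩))
    · exact fun f hf => Or.inr (hQe' _ (Or.inr (by simpa using hRe f hf)))

/-- Two separate Hamiltonian paths need not do: `uv` may itself be in `S`, and then the path through
it is that single edge. So only the half of `x, y` gets a Hamiltonian path. An edge `ac` of it is
removed, and a 2-path of the other half joins `u` to `v` and `a` to `c`; its second path is the
detour. -/
theorem linked_of_pairs_split (hm : 4 ≤ m) (hE : HasPathsThroughPairs m)
    (hF : HasTwoPathsThroughPairs m) (hd : Uncrossed d S)
    (h : Admissible S (half d b u) (half d b v) (half d (!b) x) (half d (!b) y)) :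
    Linked (hypercube (m + 1)) S (half d b u) (half d b v) (half d (!b) x) (half d (!b) y) := by
  have hc := h.card_le
  have hc' := card_restrictEdges_add_le d b S
  have hB := card_touched_le (S := restrictEdges d b S)
  have hx := forall_mem_restrictEdges_notMem h.notMem_x
  have hy := forall_mem_restrictEdges_notMem h.notMem_y
  obtain ⟨Q, hQ, hQs, hQe⟩ := hE (restrictEdges d (!b) S) x y (by omega)
    (restrictEdges_subset_edgeSet h.mem_edgeSet) (parity_half_ne_iff.1 h.parity_right)
    (fun h => hx _ h (by simp)) (fun e he _ _ hxe => absurd hxe (hx e he))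
    (fun e he _ _ hye => absurd hye (hy e he))
  have hl := hQ.length_of_spanning hQs
  have hm' := sixteen_le_card_vertices hm
  have hB' : (touched (restrictEdges d b S) ∪ {u, v}).card ≤ 2 * (restrictEdges d b S).card + 2 :=
    (Finset.card_union_le _ _).trans (add_le_add hB Finset.card_le_two)
  -- The twins of `a` and `c` must also differ from `u` and `v`. This raises the number of excluded
  -- edges to at most 12, still below 15.
  obtain ⟨a, c, hac, hacS, ha, hc⟩ := hQ.exists_edge_avoiding (restrictEdges d (!b) S)
    (touched (restrictEdges d b S) ∪ {u, v}) (by omega)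
  simp only [Finset.mem_union, Finset.mem_insert, Finset.mem_singleton, not_or] at ha hc
  obtain ⟨P, R, hPR, hPRe⟩ := hF (restrictEdges d b S) u v a c
    { card_le := by omega
      mem_edgeSet := restrictEdges_subset_edgeSet h.mem_edgeSet
      parity_left := parity_half_ne_iff.1 h.parity_left
      parity_right := parity_ne_of_adj (Q.adj_of_mem_edges hac)
      ux := Ne.symm ha.2.1
      uy := Ne.symm hc.2.1
      vx := Ne.symm ha.2.2
      vy := Ne.symm hc.2.2
      notMem_x := fun _ he => notMem_of_notMem_touched ha.1 he
      notMem_y := fun _ he => notMem_of_notMem_touched hc.1 he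
      once_u := h.once_u.restrictEdges
      once_v := h.once_v.restrictEdges }
  obtain ⟨Q', hQ', hQs', hQe'⟩ := (isPath_halfWalk (d := d) (b := !b) hQ).exists_splice
    (map_half_mem_edges_halfWalk.2 hac) (isPath_halfWalk (b := b) hPR.isPath_right)
    half_adj_half_not.symm half_adj_half_not.symm
    (fun a h h' => forall_mem_support_halfWalk_notMem a h' h)
  refine ⟨halfWalk d b P, Q', ⟨isPath_halfWalk hPR.isPath_left, hQ', fun a ha => ?_,
    fun a => ?_⟩, hd.forall_mem b ?_ ?_⟩
  · rw [hQs']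
    rcases exists_eq_half d b a with ⟨w, rfl⟩ | ⟨w, rfl⟩
    · simpa using hPR.disjoint w (by simpa using ha)
    · simp at ha
  · rw [hQs']
    rcases exists_eq_half d b a with ⟨w, rfl⟩ | ⟨w, rfl⟩
    · simpa using hPR.spanning w
    · simp [hQs]
  · exact fun f hf => (hPRe f hf).imp (fun h => by simpa using h)
      (fun h => hQe' _ (Or.inr (by simpa using h)))
  · refine fun f hf => Or.inr (hQe' _ (Or.inl ⟨by simpa using hQe f hf, ?_⟩))
    exact fun h => hacS (map_half_eq_iff.1 h ▸ hf)

/-- The path from `x` crosses at `w` and covers the whole other half on its way to `y`. -/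
theorem linked_of_right_end_split (hm : 4 ≤ m) (hE : HasPathsThroughPairs m)
    (hF : HasTwoPathsThroughPairs m) (hd : Uncrossed d S)
    (h : Admissible S (half d b u) (half d b v) (half d b x) (half d (!b) y)) :
    Linked (hypercube (m + 1)) S (half d b u) (half d b v) (half d b x) (half d (!b) y) := by
  have hc := h.card_le
  have hc' := card_restrictEdges_add_le d b S
  have hy := forall_mem_restrictEdges_notMem h.notMem_y
  have hxy := parity_half_ne_half_not_iff.1 h.parity_right
  obtain ⟨w, hw, hwB, hw₀, hw₁⟩ := exists_untouched hm hc d b x {u, v}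
    (Finset.card_le_two.trans (by simp))
  simp only [Finset.mem_insert, Finset.mem_singleton, not_or] at hwB
  obtain ⟨P, Q, hPQ, hPQe⟩ := hF (restrictEdges d b S) u v x w
    { card_le := by omega
      mem_edgeSet := restrictEdges_subset_edgeSet h.mem_edgeSet
      parity_left := parity_half_ne_iff.1 h.parity_left
      parity_right := hw.symm
      ux := by simpa using h.ux
      uy := Ne.symm hwB.1
      vx := by simpa using h.vx
      vy := Ne.symm hwB.2
      notMem_x := forall_mem_restrictEdges_notMem h.notMem_x
      notMem_y := fun _ he => notMem_of_notMem_touched hw₀ he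
      once_u := h.once_u.restrictEdges
      once_v := h.once_v.restrictEdges }
  obtain ⟨R, hR, hRs, hRe⟩ := hE.of_notMem_touched (by omega)
    (restrictEdges_subset_edgeSet h.mem_edgeSet) (hxy ▸ hw) hw₁
    (fun e he _ _ hye => absurd hye (hy e he))
  obtain ⟨Q', hQ', hQs', hQe'⟩ := (isPath_halfWalk (d := d) (b := b)
    hPQ.isPath_right).exists_append_of_adj (isPath_halfWalk hR) half_adj_half_not
    forall_mem_support_halfWalk_notMem
  refine ⟨halfWalk d b P, Q', ⟨isPath_halfWalk hPQ.isPath_left, hQ', fun a ha => ?_,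
    fun a => ?_⟩, hd.forall_mem b ?_ ?_⟩
  · rw [hQs']
    rcases exists_eq_half d b a with ⟨w, rfl⟩ | ⟨w, rfl⟩
    · simpa using hPQ.disjoint w (by simpa using ha)
    · simp at ha
  · rw [hQs']
    rcases exists_eq_half d b a with ⟨w, rfl⟩ | ⟨w, rfl⟩
    · simpa using hPQ.spanning w
    · simp [hRs]
  · exact fun f hf => (hPQe f hf).imp (fun h => by simpa using h)
      (fun h => hQe' _ (Or.inl (by simpa using h)))
  · exact fun f hf => Or.inr (hQe' _ (Or.inr (by simpa using hRe f hf)))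

/-- Here `u` may be touched by an edge of `S`, but the crossing point `w` is not, so the Hamiltonian
path from `w` to `v` in the other half exists even if an edge of `S` ends at `v`. -/
theorem linked_of_left_end_split (hm : 4 ≤ m) (hE : HasPathsThroughPairs m)
    (hF : HasTwoPathsThroughPairs m) (hd : Uncrossed d S)
    (h : Admissible S (half d b u) (half d (!b) v) (half d b x) (half d b y)) :
    Linked (hypercube (m + 1)) S (half d b u) (half d (!b) v) (half d b x) (half d b y) := by
  have hc := h.card_le
  have hc' := card_restrictEdges_add_le d b S
  have huv := parity_half_ne_half_not_iff.1 h.parity_left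
  obtain ⟨w, hw, hwB, hw₀, hw₁⟩ := exists_untouched hm hc d b u {x, y}
    (Finset.card_le_two.trans (by simp))
  simp only [Finset.mem_insert, Finset.mem_singleton, not_or] at hwB
  obtain ⟨P, Q, hPQ, hPQe⟩ := hF (restrictEdges d b S) u w x y
    { card_le := by omega
      mem_edgeSet := restrictEdges_subset_edgeSet h.mem_edgeSet
      parity_left := hw.symm
      parity_right := parity_half_ne_iff.1 h.parity_right
      ux := by simpa using h.ux
      uy := by simpa using h.uy
      vx := hwB.1
      vy := hwB.2
      notMem_x := forall_mem_restrictEdges_notMem h.notMem_x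
      notMem_y := forall_mem_restrictEdges_notMem h.notMem_y
      once_u := h.once_u.restrictEdges
      once_v := touchedOnce_of_notMem_touched hw₀ }
  obtain ⟨R, hR, hRs, hRe⟩ := hE.of_notMem_touched (by omega)
    (restrictEdges_subset_edgeSet h.mem_edgeSet) (huv ▸ hw) hw₁ h.once_v.restrictEdges
  obtain ⟨P', hP', hPs', hPe'⟩ := (isPath_halfWalk (d := d) (b := b)
    hPQ.isPath_left).exists_append_of_adj (isPath_halfWalk hR) half_adj_half_not
    forall_mem_support_halfWalk_notMem
  refine ⟨P', halfWalk d b Q, ⟨hP', isPath_halfWalk hPQ.isPath_right, fun a ha => ?_,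
    fun a => ?_⟩, hd.forall_mem b ?_ ?_⟩
  · rw [hPs'] at ha
    rcases exists_eq_half d b a with ⟨w, rfl⟩ | ⟨w, rfl⟩
    · simpa using hPQ.disjoint w (by simpa using ha)
    · simp
  · rw [hPs']
    rcases exists_eq_half d b a with ⟨w, rfl⟩ | ⟨w, rfl⟩
    · simpa using hPQ.spanning w
    · simp [hRs]
  · exact fun f hf => (hPQe f hf).imp (fun h => hPe' _ (Or.inl (by simpa using h)))
      (fun h => by simpa using h)
  · exact fun f hf => Or.inl (hPe' _ (Or.inr (by simpa using hRe f hf)))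

/-- Both paths cross, at `w` and at `z`, and each half carries a 2-path. -/
theorem linked_of_both_split (hm : 4 ≤ m) (hF : HasTwoPathsThroughPairs m) (hd : Uncrossed d S)
    (h : Admissible S (half d b u) (half d (!b) v) (half d b x) (half d (!b) y)) :
    Linked (hypercube (m + 1)) S (half d b u) (half d (!b) v) (half d b x) (half d (!b) y) := by
  have hc := h.card_le
  have hc' := card_restrictEdges_add_le d b S
  have huv := parity_half_ne_half_not_iff.1 h.parity_left
  have hxy := parity_half_ne_half_not_iff.1 h.parity_right
  obtain ⟨w, hw, hwB, hw₀, hw₁⟩ := exists_untouched hm hc d b u {x, y}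
    (Finset.card_le_two.trans (by simp))
  -- In one half `z` must differ from `u` and `w`, in the other from `v` and `w`.
  obtain ⟨z, hz, hzB, hz₀, hz₁⟩ := exists_untouched hm hc d b x {u, v, w} Finset.card_le_three
  simp only [Finset.mem_insert, Finset.mem_singleton, not_or] at hwB hzB
  obtain ⟨P₀, Q₀, h₀, h₀e⟩ := hF (restrictEdges d b S) u w x z
    { card_le := by omega
      mem_edgeSet := restrictEdges_subset_edgeSet h.mem_edgeSet
      parity_left := hw.symm
      parity_right := hz.symm
      ux := by simpa using h.ux
      uy := Ne.symm hzB.1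
      vx := hwB.1
      vy := Ne.symm hzB.2.2
      notMem_x := forall_mem_restrictEdges_notMem h.notMem_x
      notMem_y := fun _ he => notMem_of_notMem_touched hz₀ he
      once_u := h.once_u.restrictEdges
      once_v := touchedOnce_of_notMem_touched hw₀ }
  obtain ⟨P₁, Q₁, h₁, h₁e⟩ := hF (restrictEdges d (!b) S) w v z y
    { card_le := by omega
      mem_edgeSet := restrictEdges_subset_edgeSet h.mem_edgeSet
      parity_left := huv ▸ hw
      parity_right := hxy ▸ hz
      ux := Ne.symm hzB.2.2
      uy := hwB.2
      vx := Ne.symm hzB.2.1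
      vy := by simpa using h.vy
      notMem_x := fun _ he => notMem_of_notMem_touched hz₁ he
      notMem_y := forall_mem_restrictEdges_notMem h.notMem_y
      once_u := touchedOnce_of_notMem_touched hw₁
      once_v := h.once_v.restrictEdges }
  obtain ⟨P, hP, hPs, hPe⟩ := (isPath_halfWalk (d := d) (b := b)
    h₀.isPath_left).exists_append_of_adj (isPath_halfWalk h₁.isPath_left) half_adj_half_not
    forall_mem_support_halfWalk_notMem
  obtain ⟨Q, hQ, hQs, hQe⟩ := (isPath_halfWalk (d := d) (b := b)
    h₀.isPath_right).exists_append_of_adj (isPath_halfWalk h₁.isPath_right) half_adj_half_not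
    forall_mem_support_halfWalk_notMem
  refine ⟨P, Q, ⟨hP, hQ, fun a ha => ?_, fun a => ?_⟩, hd.forall_mem b ?_ ?_⟩
  · rw [hPs] at ha
    rw [hQs]
    rcases exists_eq_half d b a with ⟨w, rfl⟩ | ⟨w, rfl⟩
    · simpa using h₀.disjoint w (by simpa using ha)
    · simpa using h₁.disjoint w (by simpa using ha)
  · rw [hPs, hQs]
    rcases exists_eq_half d b a with ⟨w, rfl⟩ | ⟨w, rfl⟩
    · simpa using h₀.spanning w
    · simpa using h₁.spanning w
  · exact fun f hf => (h₀e f hf).imp (fun h => hPe _ (Or.inl (by simpa using h)))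
      (fun h => hQe _ (Or.inl (by simpa using h)))
  · exact fun f hf => (h₁e f hf).imp (fun h => hPe _ (Or.inr (by simpa using h)))
      (fun h => hQe _ (Or.inr (by simpa using h)))

theorem HasTwoPathsThroughPairs.succ (hm : 4 ≤ m) (hE : HasPathsThroughPairs m)
    (hF : HasTwoPathsThroughPairs m) : HasTwoPathsThroughPairs (m + 1) := by
  intro S u v x y h
  have hc := h.card_le
  obtain ⟨d, hd⟩ := exists_uncrossed S h.mem_edgeSet (by omega)
  obtain ⟨b, hb⟩ : ∃ b, u d = b := ⟨_, rfl⟩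
  obtain ⟨u, rfl⟩ := exists_eq_half_of_apply hb
  rcases exists_eq_half d b v with ⟨v, rfl⟩ | ⟨v, rfl⟩ <;>
  rcases exists_eq_half d b x with ⟨x, rfl⟩ | ⟨x, rfl⟩ <;>
  rcases exists_eq_half d b y with ⟨y, rfl⟩ | ⟨y, rfl⟩
  · exact linked_of_same_half hm hE hF hd h
  · exact linked_of_right_end_split hm hE hF hd h
  · exact (linked_of_right_end_split hm hE hF hd h.swap_right).swap_right
  · exact linked_of_pairs_split hm hE hF hd h
  · exact linked_of_left_end_split hm hE hF hd h
  · exact linked_of_both_split hm hF hd h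
  · exact (linked_of_both_split hm hF hd h.swap_right).swap_right
  -- Here `u` is alone in its half. Renaming the halves and exchanging `u` and `v` gives the case in
  -- which `v` is alone.
  · obtain ⟨c, rfl⟩ : ∃ c, b = !c := ⟨!b, by simp⟩
    simp only [Bool.not_not] at h ⊢
    exact (linked_of_left_end_split hm hE hF hd h.swap_left).swap_left

end step

/-! ### Invariance under automorphisms -/

section transport

variable {V : Type*}

/-- A Hamiltonian path from `u` to `v` exists through any at most two edges that do not
obviously preclude it. -/
def PairTraceable (G : SimpleGraph V) (u v : V) : Prop :=
  ∀ S : Finset (Sym2 V), S.card ≤ 2 → (∀ e ∈ S, e ∈ G.edgeSet) → s(u, v) ∉ S →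
    TouchedOnce S u → TouchedOnce S v →
    ∃ P : G.Walk u v, P.IsPath ∧ (∀ a, a ∈ P.support) ∧ ∀ e ∈ S, e ∈ P.edges

/-- A spanning `2`-path `P_{uv} + P_{xy}` exists through any at most two edges that avoid `x` and
`y` and do not meet in `u` or `v`. -/
def PairLinkable (G : SimpleGraph V) (u v x y : V) : Prop :=
  ∀ S : Finset (Sym2 V), S.card ≤ 2 → (∀ e ∈ S, e ∈ G.edgeSet) → (∀ e ∈ S, x ∉ e) →
    (∀ e ∈ S, y ∉ e) → TouchedOnce S u → TouchedOnce S v → Linked G S u v x y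

variable {G : SimpleGraph V} (φ : G ≃g G)

theorem touchedOnce_map {S : Finset (Sym2 V)} {u : V} (h : TouchedOnce S u) :
    TouchedOnce (S.map ⟨Sym2.map φ, Sym2.map.injective φ.injective⟩) (φ u) := by
  intro e he f hf hue huf
  obtain ⟨e, he', rfl⟩ := Finset.mem_map.1 he
  obtain ⟨f, hf', rfl⟩ := Finset.mem_map.1 hf
  obtain ⟨w, hw, hwu⟩ := Sym2.mem_map.1 hue
  obtain ⟨z, hz, hzu⟩ := Sym2.mem_map.1 huf
  cases φ.injective hwu
  cases φ.injective hzu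
  rw [h e he' f hf' hw hz]

theorem forall_mem_map_notMem {S : Finset (Sym2 V)} {u : V} (h : ∀ e ∈ S, u ∉ e) :
    ∀ e ∈ S.map ⟨Sym2.map φ, Sym2.map.injective φ.injective⟩, φ u ∉ e := by
  intro e he hu
  obtain ⟨e, he', rfl⟩ := Finset.mem_map.1 he
  obtain ⟨w, hw, hwu⟩ := Sym2.mem_map.1 hu
  cases φ.injective hwu
  exact h e he' hw

theorem forall_mem_map_mem_edgeSet {S : Finset (Sym2 V)} (h : ∀ e ∈ S, e ∈ G.edgeSet) :
    ∀ e ∈ S.map ⟨Sym2.map φ, Sym2.map.injective φ.injective⟩, e ∈ G.edgeSet := by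
  intro e he
  obtain ⟨e, he', rfl⟩ := Finset.mem_map.1 he
  have := h e he'
  induction e with | _ a b =>
  exact φ.map_adj_iff.2 this

/-- The preimage of a walk under an automorphism. -/
def pullWalk {u v : V} (P : G.Walk (φ u) (φ v)) : G.Walk u v :=
  (P.map φ.symm.toHom).copy (φ.symm_apply_apply u) (φ.symm_apply_apply v)

theorem isPath_pullWalk {u v : V} {P : G.Walk (φ u) (φ v)} (hP : P.IsPath) :
    (pullWalk φ P).IsPath := by
  rw [pullWalk, SimpleGraph.Walk.isPath_copy]
  exact hP.map φ.symm.injective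

theorem mem_support_pullWalk {u v a : V} {P : G.Walk (φ u) (φ v)} :
    a ∈ (pullWalk φ P).support ↔ φ a ∈ P.support := by
  rw [pullWalk, SimpleGraph.Walk.support_copy, SimpleGraph.Walk.support_map, List.mem_map]
  constructor
  · rintro ⟨w, hw, rfl⟩
    rwa [show φ (φ.symm.toHom w) = w from φ.apply_symm_apply w]
  · exact fun h => ⟨φ a, h, φ.symm_apply_apply a⟩

theorem mem_edges_pullWalk {u v : V} {P : G.Walk (φ u) (φ v)} {e : Sym2 V}
    (h : Sym2.map φ e ∈ P.edges) : e ∈ (pullWalk φ P).edges := by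
  rw [pullWalk, SimpleGraph.Walk.edges_copy, SimpleGraph.Walk.edges_map, List.mem_map]
  refine ⟨_, h, ?_⟩
  rw [Sym2.map_map, show φ.symm.toHom ∘ φ = id from funext φ.symm_apply_apply, Sym2.map_id]
  rfl

theorem PairTraceable.of_iso {u v : V} (h : PairTraceable G (φ u) (φ v)) :
    PairTraceable G u v := by
  intro S hc hS huv hu hv
  obtain ⟨P, hP, hPs, hPe⟩ := h _ ((Finset.card_map _).trans_le hc)
    (forall_mem_map_mem_edgeSet φ hS)
    (fun h => by
      obtain ⟨e, he, h⟩ := Finset.mem_map.1 h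
      exact huv (Sym2.map.injective φ.injective (a₂ := s(u, v)) h ▸ he))
    (touchedOnce_map φ hu) (touchedOnce_map φ hv)
  exact ⟨pullWalk φ P, isPath_pullWalk φ hP, fun a => (mem_support_pullWalk φ).2 (hPs _),
    fun e he => mem_edges_pullWalk φ (hPe _ (Finset.mem_map_of_mem _ he))⟩

theorem PairLinkable.of_iso {u v x y : V} (h : PairLinkable G (φ u) (φ v) (φ x) (φ y)) :
    PairLinkable G u v x y := by
  intro S hc hS hx hy hu hv
  obtain ⟨P, Q, hPQ, hPQe⟩ := h _ ((Finset.card_map _).trans_le hc)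
    (forall_mem_map_mem_edgeSet φ hS) (forall_mem_map_notMem φ hx) (forall_mem_map_notMem φ hy)
    (touchedOnce_map φ hu) (touchedOnce_map φ hv)
  refine ⟨pullWalk φ P, pullWalk φ Q, ⟨isPath_pullWalk φ hPQ.isPath_left,
    isPath_pullWalk φ hPQ.isPath_right, fun a => ?_, fun a => ?_⟩, fun e he => ?_⟩
  · simpa only [mem_support_pullWalk] using hPQ.disjoint (φ a)
  · simpa only [mem_support_pullWalk] using hPQ.spanning (φ a)
  · exact (hPQe _ (Finset.mem_map_of_mem _ he)).imp (mem_edges_pullWalk φ) (mem_edges_pullWalk φ)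

/-- Allowing `e = f` treats one and two prescribed edges alike; only the empty set remains apart. -/
theorem Finset.exists_forall_mem_eq_or_eq {α : Type*} {S : Finset α} (hS : S.Nonempty)
    (hc : S.card ≤ 2) : ∃ e ∈ S, ∃ f ∈ S, ∀ g ∈ S, g = e ∨ g = f := by
  classical
  obtain ⟨e, he⟩ := hS
  have h1 : (S.erase e).card ≤ 1 := by
    rw [Finset.card_erase_of_mem he]
    omega
  rcases (S.erase e).eq_empty_or_nonempty with h | ⟨f, hf⟩
  · refine ⟨e, he, e, he, fun g hg => ?_⟩
    by_contra hne
    have : g ∈ S.erase e := Finset.mem_erase.2 ⟨by tauto, hg⟩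
    simp [h] at this
  · refine ⟨e, he, f, Finset.mem_of_mem_erase hf, fun g hg => ?_⟩
    by_cases hge : g = e
    · exact Or.inl hge
    · exact Or.inr (Finset.card_le_one.1 h1 g (Finset.mem_erase.2 ⟨hge, hg⟩) f hf)

end transport

/-- The automorphism of `Q_n` that permutes the coordinates and then adds `t`. -/
def cubeIso {n : ℕ} (σ : Equiv.Perm (Fin n)) (t : Fin n → Bool) :
    hypercube n ≃g hypercube n where
  toFun a i := a (σ i) ^^ t i
  invFun a i := a (σ.symm i) ^^ t (σ.symm i)
  left_inv a := by
    funext i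
    simp
  right_inv a := by
    funext i
    simp
  map_rel_iff' := by
    intro a b
    simp only [hypercube_adj_iff, Equiv.coe_fn_mk, ne_eq, Bool.xor_left_inj]
    rw [Equiv.sum_comp σ fun i => if ¬a i = b i then 1 else 0]

/-! ### Certificates for `Q_4`: encoding, checkers and tables -/

section words

/-- The vertex of `Q_4` whose coordinates are the binary digits of `c`. -/
def word (c : ℕ) : Fin 4 → Bool := fun i => c.testBit i

def wordCode (a : Fin 4 → Bool) : ℕ :=
  (a 0).toNat + 2 * (a 1).toNat + 4 * (a 2).toNat + 8 * (a 3).toNat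

theorem word_wordCode (a : Fin 4 → Bool) : word (wordCode a) = a := by
  revert a
  decide +kernel

theorem wordCode_lt (a : Fin 4 → Bool) : wordCode a < 16 := by
  revert a
  decide +kernel

theorem wordCode_word {c : ℕ} (h : c < 16) : wordCode (word c) = c := by
  revert c
  decide +kernel

theorem word_inj {c c' : ℕ} (h : c < 16) (h' : c' < 16) : word c = word c' ↔ c = c' :=
  ⟨fun hw => by rw [← wordCode_word h, hw, wordCode_word h'], fun h => h ▸ rfl⟩

def codeAdj (a b : ℕ) : Bool := [1, 2, 4, 8].contains (a ^^^ b)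

theorem adj_of_codeAdj {a b : ℕ} (h : codeAdj a b) : (hypercube 4).Adj (word a) (word b) := by
  have key : ∀ k ∈ [1, 2, 4, 8], ∑ i : Fin 4, (if k.testBit i = true then 1 else 0) = 1 := by
    decide
  rw [hypercube_adj_iff]
  refine Eq.trans ?_ (key (a ^^^ b) (by simpa [codeAdj] using h))
  refine Finset.sum_congr rfl fun i _ => if_congr ?_ rfl rfl
  simp [word, Nat.testBit_xor]

/-- The edges of `Q_4` as pairs of codes. -/
def codeEdges : List (ℕ × ℕ) :=
  (List.range 16).flatMap fun a =>
    ((List.range 16).filter fun b => Nat.blt a b && codeAdj a b).map (Prod.mk a)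

theorem mem_codeEdges_lt : ∀ p ∈ codeEdges, p.1 < 16 ∧ p.2 < 16 := by decide +kernel

theorem exists_mem_codeEdges {e : Sym2 (Fin 4 → Bool)} (he : e ∈ (hypercube 4).edgeSet) :
    ∃ p ∈ codeEdges, e = s(word p.1, word p.2) := by
  have key : ∀ a ∈ List.range 16, ∀ b ∈ List.range 16,
      ∑ i, (if word a i ≠ word b i then 1 else 0) = 1 →
      (a, b) ∈ codeEdges ∨ (b, a) ∈ codeEdges := by decide +kernel
  induction e with | _ a b =>
  rcases key _ (List.mem_range.2 (wordCode_lt a)) _ (List.mem_range.2 (wordCode_lt b))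
    (by rw [word_wordCode, word_wordCode]; exact hypercube_adj_iff.1 he) with h | h
  · exact ⟨_, h, by simp only [word_wordCode]⟩
  · exact ⟨_, h, by simp only [word_wordCode, Sym2.eq_swap]⟩

/-- `a :: l` lists the vertices of a walk that ends at `b`. -/
def isCodeWalk : ℕ → List ℕ → ℕ → Bool
  | a, [], b => a == b
  | a, c :: l, b => codeAdj a c && isCodeWalk c l b

/-- The edges of the walk `a :: l`, the edge `cc'` being recorded by the bits `16c + c'` and
`16c' + c`. -/
def edgeMask : ℕ → List ℕ → ℕ
  | _, [] => 0
  | a, c :: l => (2 ^ (16 * a + c) ||| 2 ^ (16 * c + a)) ||| edgeMask c l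

theorem exists_walk_of_isCodeWalk {a b : ℕ} {l : List ℕ} (h : isCodeWalk a l b)
    (hl : ∀ c ∈ a :: l, c < 16) :
    ∃ W : (hypercube 4).Walk (word a) (word b), W.support = (a :: l).map word ∧
      ∀ p < 16, ∀ q < 16, (edgeMask a l).testBit (16 * p + q) →
        s(word p, word q) ∈ W.edges := by
  induction l generalizing a with
  | nil =>
    obtain rfl : a = b := by simpa [isCodeWalk] using h
    exact ⟨.nil, by simp, by simp [edgeMask]⟩
  | cons c l ih =>
    rw [isCodeWalk, Bool.and_eq_true] at h
    obtain ⟨W, hW, hWe⟩ := ih h.2 fun x hx => hl x (List.mem_cons_of_mem _ hx)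
    have ha := hl a (by simp)
    have hc := hl c (by simp)
    refine ⟨.cons (adj_of_codeAdj h.1) W, by simp [hW], fun p hp q hq hpq => ?_⟩
    rw [SimpleGraph.Walk.edges_cons, List.mem_cons]
    simp only [edgeMask, Nat.testBit_or, Nat.testBit_two_pow, Bool.or_eq_true,
      decide_eq_true_eq] at hpq
    rcases hpq with (h | h) | h
    -- All four codes are below 16, so `16 * a + c` determines `a` and `c`.
    · obtain ⟨rfl, rfl⟩ : a = p ∧ c = q := by omega
      exact Or.inl rfl
    · obtain ⟨rfl, rfl⟩ : c = p ∧ a = q := by omega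
      exact Or.inl Sym2.eq_swap
    · exact Or.inr (hWe p hp q hq h)

/-- The last `k` hexadecimal digits of a number, starting with the last one. -/
def hexDigits : ℕ → ℕ → List ℕ
  | 0, _ => []
  | k + 1, p => p % 16 :: hexDigits k (p / 16)

theorem lt_of_mem_hexDigits {k p c : ℕ} (h : c ∈ hexDigits k p) : c < 16 := by
  induction k generalizing p with
  | zero => simp [hexDigits] at h
  | succ k ih =>
    rcases List.mem_cons.1 h with rfl | h
    · exact Nat.mod_lt _ (by simp)
    · exact ih h

/-- `l` has no repetitions and lists precisely the vertices of `Q_4` whose codes are not the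
positions of the binary ones of `s`. -/
def isCodeList : List ℕ → ℕ → Bool
  | [], s => Nat.beq s 65535
  | c :: l, s => !s.testBit c && isCodeList l (s ||| 2 ^ c)

/-- The bits of `s` mark the codes already passed. Carrying the second conjunct through the
induction shows that a code cannot recur once its bit is set. -/
theorem nodup_of_isCodeList {l : List ℕ} {s : ℕ} (h : isCodeList l s) :
    l.Nodup ∧ ∀ c ∈ l, s.testBit c = false := by
  induction l generalizing s with
  | nil => simp
  | cons c l ih =>
    rw [isCodeList, Bool.and_eq_true, Bool.not_eq_true'] at h
    obtain ⟨h1, h2⟩ := ih h.2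
    refine ⟨List.nodup_cons.2 ⟨fun hc => ?_, h1⟩, fun x hx => ?_⟩
    · simpa [Nat.testBit_or, Nat.testBit_two_pow_self] using h2 c hc
    · rcases List.mem_cons.1 hx with rfl | hx
      · exact h.1
      · have := h2 x hx
        rw [Nat.testBit_or, Bool.or_eq_false_iff] at this
        exact this.1

theorem mem_of_isCodeList {l : List ℕ} {s : ℕ} (h : isCodeList l s) {c : ℕ} (hc : c < 16) :
    c ∈ l ∨ s.testBit c := by
  induction l generalizing s with
  | nil =>
    -- `65535 = 2 ^ 16 - 1` marks all sixteen codes as passed.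
    obtain rfl : s = 65535 := Nat.eq_of_beq_eq_true h
    revert c
    decide
  | cons x l ih =>
    rw [isCodeList, Bool.and_eq_true] at h
    rcases ih h.2 with h | h
    · exact Or.inl (List.mem_cons_of_mem _ h)
    · rw [Nat.testBit_or, Nat.testBit_two_pow, Bool.or_eq_true, decide_eq_true_eq] at h
      rcases h with h | rfl
      · exact Or.inr h
      · exact Or.inl (by simp)

theorem nodup_map_word_of_isCodeList {l : List ℕ} (h : isCodeList l 0) (hl : ∀ c ∈ l, c < 16) :
    (l.map word).Nodup :=
  (nodup_of_isCodeList h).1.map_on fun x hx y hy hxy => (word_inj (hl x hx) (hl y hy)).1 hxy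

theorem mem_map_word_of_isCodeList {l : List ℕ} (h : isCodeList l 0) (a : Fin 4 → Bool) :
    a ∈ l.map word :=
  List.mem_map.2 ⟨wordCode a, (mem_of_isCodeList h (wordCode_lt a)).resolve_right (by simp),
    word_wordCode a⟩

/-- Any two of the given edges that satisfy `ok` are recorded in one of the masks. -/
def coversPairs (E : List (ℕ × ℕ)) (ok : ℕ × ℕ → ℕ × ℕ → Bool) (M : List ℕ) : Bool :=
  E.all fun e => let M' := M.filter fun k => k.testBit (16 * e.1 + e.2)
    E.all fun f => !ok e f || M'.any fun k => k.testBit (16 * f.1 + f.2)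

theorem exists_mem_of_coversPairs {E : List (ℕ × ℕ)} {ok : ℕ × ℕ → ℕ × ℕ → Bool} {M : List ℕ}
    (h : coversPairs E ok M) {e f : ℕ × ℕ} (he : e ∈ E) (hf : f ∈ E) (hok : ok e f) :
    ∃ k ∈ M, k.testBit (16 * e.1 + e.2) ∧ k.testBit (16 * f.1 + f.2) := by
  simp only [coversPairs, List.all_eq_true, Bool.or_eq_true, Bool.not_eq_true',
    List.any_eq_true, List.mem_filter] at h
  obtain ⟨k, ⟨hk, h1⟩, h2⟩ := (h e he f hf).resolve_left (by simp [hok])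
  exact ⟨k, hk, h1, h2⟩

/-- `e` and `f` are equal or do not both contain `c`. -/
def meetsOnce (c : ℕ) (e f : ℕ × ℕ) : Bool :=
  e == f || !((e.1 == c || e.2 == c) && (f.1 == c || f.2 == c))

def avoidsCode (c : ℕ) (e : ℕ × ℕ) : Bool := e.1 != c && e.2 != c

def pathMask (p : ℕ) : ℕ := edgeMask 0 (hexDigits 16 p).tail

def checkPath (v p : ℕ) : Bool :=
  (hexDigits 16 p).head? == some 0 && isCodeWalk 0 (hexDigits 16 p).tail v &&
    isCodeList (hexDigits 16 p) 0

/-- Pairs in `codeEdges` have the smaller code first, so the edge between `0` and `v` can only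
appear as `(0, v)`. Nonemptiness of `T` serves the case of no prescribed edge. -/
def checkHamiltonian (v : ℕ) (T : List ℕ) : Bool :=
  Nat.blt v 16 && !T.isEmpty && T.all (checkPath v) &&
    coversPairs (codeEdges.filter fun e => !(e.1 == 0 && e.2 == v))
      (fun e f => meetsOnce 0 e f && meetsOnce v e f) (T.map pathMask)

/-- The digit `v` ends the first path, so it marks the cut; the `+ 1` keeps `v` itself on the left.
-/
def leftPart (v : ℕ) (p : ℕ) : List ℕ := (hexDigits 16 p).take ((hexDigits 16 p).idxOf v + 1)

def rightPart (v : ℕ) (p : ℕ) : List ℕ := (hexDigits 16 p).drop ((hexDigits 16 p).idxOf v + 1)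

def twoPathMask (v x p : ℕ) : ℕ :=
  edgeMask 0 (leftPart v p).tail ||| edgeMask x (rightPart v p).tail

def checkTwoPath (v x y p : ℕ) : Bool :=
  (leftPart v p).head? == some 0 && (rightPart v p).head? == some x &&
    isCodeWalk 0 (leftPart v p).tail v && isCodeWalk x (rightPart v p).tail y &&
    isCodeList (hexDigits 16 p) 0

def checkLinked (v x y : ℕ) (T : List ℕ) : Bool :=
  Nat.blt v 16 && Nat.blt x 16 && Nat.blt y 16 && !T.isEmpty && T.all (checkTwoPath v x y) &&
    coversPairs (codeEdges.filter fun e => avoidsCode x e && avoidsCode y e)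
      (fun e f => meetsOnce 0 e f && meetsOnce v e f) (T.map (twoPathMask v x))

/-- For two representatives `v` of the odd vertices of `Q_4`, Hamiltonian paths from `0` to `v`
such that any two edges that can lie on a common path lie on one of them. A path is encoded by the
number whose hexadecimal digits are its vertices, the first vertex being the last digit. -/
def hamiltonianTable : List (ℕ × List ℕ) := [
  (1, [
    0x132abf76ec45d980, 0x1573b9dfea8c4620, 0x198cdfbae6237540, 0x19b37fecd5462a80,
    0x132ab98cefd57640, 0x154cd98ae67fb320, 0x137fb98cd546ea20, 0x15d98ab3267fec40,
    0x13b9df75462aec80, 0x19d54c8abfe67320, 0x15467fb32aecd980, 0x13ba89dcef754620]),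
  (7, [
    0x7fd9b32a8ce64510, 0x75dc462aefb31980, 0x76efba8c45d91320, 0x7326eabfdc891540,
    0x762a89b315dfec40, 0x7fb9132645dcea80, 0x73264cefba89d510, 0x75132ab9dfe64c80,
    0x7fecd98ab3154620, 0x7315dfb98c46ea20, 0x754623bfea8cd910, 0x7645dc89bfea2310,
    0x75132abfd98ce640, 0x7fe62ab315d98c40, 0x73b915dfec462a80, 0x7623baefdc451980,
    0x75dfb3198c46ea20])]

/-- For representatives `(v, x, y)` under permutations of the coordinates, spanning `2`-paths
`P_{0v} + P_{xy}` of `Q_4` such that any two edges that can lie on a common `2`-path lie on one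
of them, encoded as in `hamiltonianTable`, the vertices of `P_{xy}` following those of `P_{0v}`. -/
def twoPathTable : List ((ℕ × ℕ × ℕ) × List ℕ) := [
  ((1, 3, 2), [
    0x2319dc4576efba80, 0x2315d98ceabf7640, 0x2ae6457fdc89b310, 0x2319ba8cefd57640,
    0x267fd9b3154cea80, 0x2a89bfd54ce67310, 0x264cd57feab31980, 0x2a89b31576efdc40,
    0x264c89d57feab310, 0x267fb3198aecd540, 0x2ae67fb319d54c80]),
  ((1, 3, 4), [
    0x467fb315d98cea20, 0x457fdce62319ba80, 0x4576efb9dc8a2310, 0x4c89baefd5762310,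
    0x4cd98ab3157fe620, 0x45dcefba26731980, 0x457319bfdc8ae620, 0x4623157fd9baec80,
    0x45df76ec89ba2310, 0x4ce62319d57fba80]),
  ((1, 3, 7), [
    0x7315dc46efb98a20, 0x7319bfd5462aec80, 0x73154c89dfbae620, 0x7fec8ab9d5462310,
    0x7fe62ab3198cd540, 0x762315dfb98aec40, 0x762aefb3154cd980, 0x7546ecdfb98a2310,
    0x754ce62319dfba80, 0x75dfeab98c462310, 0x7315d9bfec8a2640, 0x73198ce645dfba20]),
  ((1, 3, 13), [
    0xd57319bfe62a8c40, 0xdcea2315467fb980, 0xd98ab3157fec4620, 0xdfeab98c45762310,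
    0xd57fba23198ce640, 0xdfb3198c4576ea20, 0xdc457fe62319ba80, 0xdce6457fb98a2310,
    0xd9bf76ec8a231540, 0xd9bf73154c8ae620, 0xd9ba23157fe64c80, 0xd5762aefb3198c40]),
  ((1, 3, 14), [
    0xeabf7315d98c4620, 0xefdc45762319ba80, 0xecd5467fb98a2310, 0xefd9b315762a8c40,
    0xe6457fba2319dc80, 0xec4675dfb3198a20, 0xe62ab98cdf731540, 0xefd98c45762ab310,
    0xefba23198cd57640, 0xe6457319bfdc8a20, 0xea2315dc467fb980]),
  ((1, 6, 2), [
    0x26198ab375dfec40, 0x2613754cd9bfea80, 0x23baec89df761540, 0x237feab98cd54610,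
    0x237fbae619d54c80, 0x2613b98aecdf7540, 0x2aec461573bfd980, 0x23b9df754c8ae610,
    0x2a89b37fe615dc40, 0x26137fbaec89d540, 0x237fe619ba8cd540, 0x2a89d54cefb37610]),
  ((1, 6, 7), [
    0x76154cd98aefb320, 0x76132ab98cefd540, 0x7619d54cefb32a80, 0x754c8aefd9b32610,
    0x7546132aecdfb980, 0x7feab326198cd540, 0x732abfe615d98c40, 0x754c8ab9dfe61320,
    0x732abfec89d54610, 0x73bfd54ce6198a20, 0x7326154cefd9ba80, 0x732619baefd54c80,
    0x7fec8a2613b9d540, 0x732aefb98cd54610]),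
  ((1, 6, 8), [
    0x8abfe619dc457320, 0x8cea2619b37fd540, 0x89d57fb32aec4610, 0x89ba237fe615dc40,
    0x89baecdf75461320, 0x8a261375d9bfec40, 0x89dfb376154cea20, 0x89b3754cdfea2610,
    0x89d54cef7613ba20, 0x89ba237fecd54610, 0x8a261573b9dfec40]),
  ((1, 6, 11), [
    0xbfea2376198cd540, 0xb9df754ce6132a80, 0xb37fec4615d98a20, 0xbaefd98c45732610,
    0xb9dc8aef75461320, 0xb98aecdf73261540, 0xba2375dfec461980, 0xbfea261375d98c40,
    0xb98a237fecd54610, 0xb32619dc457fea80, 0xb9dfea2376154c80, 0xb3754619dfec8a20,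
    0xb98aefdc46157320]),
  ((1, 6, 14), [
    0xe619ba237fd54c80, 0xe6157fb32a89dc40, 0xe613754cdfb98a20, 0xefd98c4573ba2610,
    0xea8c4619d57fb320, 0xef76132ab98cd540, 0xef7326154cd9ba80, 0xea2613bf754cd980,
    0xea8c45d9bf732610, 0xea2615df73b98c40, 0xe6198abfdc457320, 0xefd9ba8c46157320,
    0xe619bf732a8cd540, 0xefb3754cd98a2610]),
  ((1, 15, 2), [
    0x26457f13baecd980, 0x2376ef15d9ba8c40, 0x2ae645dc89b37f10, 0x23bf198aecd57640,
    0x2376ec45df19ba80, 0x2ae64cdf1573b980, 0x26ef1375d9ba8c40, 0x23ba89d5764cef10,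
    0x2a8ce673b9df1540, 0x2ab37546ef19dc80, 0x2ae67f13b98cd540]),
  ((1, 15, 7), [
    0x7f154623b9dcea80, 0x7f13ba26ec89d540, 0x75dc46ef198ab320, 0x76ea23b98c45df10,
    0x7546ef13b9dc8a20, 0x73ba26ef19d54c80, 0x7326ea89bf15dc40, 0x75df13264ceab980,
    0x754623ba89dcef10, 0x73baec89df154620, 0x75df19b32a8ce640, 0x732abf1546ecd980,
    0x7623baef198cd540]),
  ((1, 15, 14), [
    0xef1375dc462ab980, 0xef19dc8ab3267540, 0xef15d9b3764c8a20, 0xe6732ab98c45df10,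
    0xef13ba89dc457620, 0xecd5467f19b32a80, 0xeab98cdf15732640, 0xecd98ab326457f10,
    0xe675df132ab98c40, 0xea2673bf19d54c80, 0xe6754cdf198ab320, 0xecd9bf1546732a80]),
  ((7, 3, 1), [
    0x137fe62ab98cd540, 0x1375dfb98aec4620, 0x19dfba237546ec80, 0x1376efb9d54c8a20,
    0x1546237fb9dcea80, 0x15dfb98cea237640, 0x15dc46237feab980, 0x154cefd98ab37620,
    0x19dc8a26efb37540, 0x137fb98cd546ea20, 0x1546237fdceab980, 0x19bfea237645dc80,
    0x198abfe62375dc40]),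
  ((7, 3, 4), [
    0x4c891375dfbae620, 0x4cefb9d513762a80, 0x46efdc89ba237510, 0x45dce6237fba8910,
    0x4519dc8aefb37620, 0x45137fd9ba26ec80, 0x46237519bfdcea80, 0x451376ec89dfba20,
    0x45dfb3762aec8910, 0x45dc8ab9137fe620, 0x46ec89dfba237510, 0x462aecd5137fb980]),
  ((7, 3, 8), [
    0x8ceabfd913754620, 0x8a2376efb915dc40, 0x89bae6237fdc4510, 0x8cefd9ba23764510,
    0x8ab9d5137fec4620, 0x8a237519bfdce640, 0x8c462aefb375d910, 0x89137fba26ecd540,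
    0x89dc451376efba20, 0x8915dfb3762aec40, 0x89d513762abfec40]),
  ((7, 3, 11), [
    0xb37fea8cd9154620, 0xb375dfec462a8910, 0xbfd98c451376ea20, 0xb37fdce62a891540,
    0xbfea23764cd51980, 0xbfd91375462aec80, 0xb37fe62a8c45d910, 0xba2375198cdfe640,
    0xb3762a8915dfec40, 0xb98cdfea23764510, 0xb37fd9154ce62a80, 0xba891375dfec4620,
    0xb9d5137fec8a2640, 0xb375198cdfea2640]),
  ((7, 3, 13), [
    0xdfbaec8913754620, 0xd9b37fe62a8c4510, 0xdfba2376ec451980, 0xd519bfec8a237640,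
    0xdfb98c46ea237510, 0xd5198ab37fec4620, 0xdc46237519bfea80, 0xdfbae62375198c40,
    0xdfb98c451376ea20, 0xd546237fbaec8910, 0xd5462ab9137fec80, 0xdc8ae6237fb91540,
    0xd54cefb3762a8910]),
  ((7, 9, 1), [
    0x1975dfb32ae64c80, 0x197fecd54623ba80, 0x1973bfe62a8cd540, 0x13baefd54c897620,
    0x1546ecdfba897320, 0x15dfb32aec897640, 0x1326efba8975dc40, 0x15d97fb326ea8c40,
    0x154cdfb97326ea80, 0x1976ec45dfb32a80, 0x13b97fd546ec8a20, 0x132abfd97546ec80,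
    0x197645dcefb32a80, 0x13b975dfea8c4620]),
  ((7, 9, 2), [
    0x23197546eabfdc80, 0x23ba89764cefd510, 0x26ea897fb315dc40, 0x2645dc8aefb97310,
    0x26ec8abfd9731540, 0x2ab31976efd54c80, 0x264513b97fdcea80, 0x2a8cd97513bfe640,
    0x23ba8cd97fe64510, 0x264cea8975dfb310, 0x2315dc8aefb97640, 0x264cefd51973ba80]),
  ((7, 9, 8), [
    0x89762aec45dfb310, 0x897fe64cd513ba20, 0x89751326eabfdc40, 0x8abfecd973264510,
    0x8a23bfecd5197640, 0x897315dfbaec4620, 0x8ab97fd54ce62310, 0x8cefd975462ab310,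
    0x8abfd976ec451320, 0x8a26ecdfb9731540, 0x8cd5197fb32ae640, 0x8aefb31975dc4620,
    0x8cd973bfea264510]),
  ((7, 9, 11), [
    0xb97fd5132a8ce640, 0xb97623154cdfea80, 0xbfea2645dc897310, 0xb31975dfe64c8a20,
    0xb326ea897fdc4510, 0xbfdcea8973154620, 0xba23197645dfec80, 0xbfdcea8975132640,
    0xb97315dfe62a8c40, 0xba8cefd975462310, 0xba89764cefd51320, 0xba23197fe645dc80,
    0xb976efdc8a231540, 0xbaefd51973264c80, 0xb3197fea8cd54620, 0xb976efd54c8a2310,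
    0xba231975dfe64c80]),
  ((7, 9, 14), [
    0xec8a2645dfb97310, 0xefdc45197623ba80, 0xe64c897fd513ba20, 0xeabfdc8975132640,
    0xefba23197645dc80, 0xea897fb3264cd510, 0xea8cdfb319754620, 0xefba8cd519732640,
    0xe62a8cd97fb31540, 0xe64c8975dfba2310, 0xefd51973ba8c4620, 0xec8abfd976451320,
    0xefb315d9762a8c40, 0xefb97645dc8a2310, 0xe64cdfb975132a80, 0xe623154cd97fba80,
    0xecdfb97315462a80]),
  ((7, 15, 1), [
    0x19d546ec8abf7320, 0x13b98a26ef75dc40, 0x19b32aef7645dc80, 0x13264ceabf75d980,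
    0x154cdf73b98ae620, 0x132abf76ec89d540, 0x1546ecd9bf732a80, 0x13baec89df754620,
    0x15dc89baef732640, 0x13b9d54c8aef7620, 0x15df73b98c46ea20]),
  ((7, 15, 8), [
    0x8cd9bf731546ea20, 0x8ab3264cef75d910, 0x8aecdf7623b91540, 0x89ba2315df76ec40,
    0x8913bf75dc46ea20, 0x89ba26ec45df7310, 0x89dceabf76451320, 0x8aecd9bf75132640,
    0x8cd9baef73264510, 0x8a26ecdf73b91540, 0x8ab319df754ce620, 0x8cd9b32aef764510]),
  ((7, 15, 11), [
    0xbf732645dcea8910, 0xbf76ea2315d98c40, 0xbf7546ecd9132a80, 0xb9df73154c8ae620,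
    0xb32ae64c89df7510, 0xbf7645dcea891320, 0xbaef73264cd51980, 0xb319dc8a26ef7540,
    0xb915df732a8ce640, 0xb98aec45df762310, 0xba8c46ef75d91320, 0xbf7645d9132aec80,
    0xbf7319d546ec8a20])]

theorem hamiltonianTable_check :
    (hamiltonianTable.all fun r => checkHamiltonian r.1 r.2) = true := by
  decide +kernel

theorem twoPathTable_check :
    (twoPathTable.all fun r => checkLinked r.1.1 r.1.2.1 r.1.2.2 r.2) = true := by
  decide +kernel

/-- Odd vertices of `Q_4` have one or three ones, and permutations of coordinates act transitively
on each kind; `1` and `7` represent them. -/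
theorem exists_perm_mem_hamiltonianTable : ∀ v : Fin 4 → Bool, parity v = 1 →
    ∃ σ : Equiv.Perm (Fin 4), wordCode (v ∘ σ) ∈ hamiltonianTable.map Prod.fst := by
  decide +kernel

/-- The triple is packed into one number in base 16, so that a table entry is matched by a single
comparison. -/
theorem exists_perm_mem_twoPathTable : ∀ v : Fin 4 → Bool, parity v = 1 →
    ∀ x, parity x = 0 → wordCode x ≠ 0 → ∀ y, parity y = 1 → v ≠ y →
    ∃ σ : Equiv.Perm (Fin 4), twoPathTable.any fun r =>
      Nat.beq (256 * r.1.1 + 16 * r.1.2.1 + r.1.2.2)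
        (256 * wordCode (v ∘ σ) + 16 * wordCode (x ∘ σ) + wordCode (y ∘ σ)) := by
  decide +kernel
-- From the checked tables to paths in `Q_4`
theorem List.eq_cons_tail_of_head? {α : Type*} [DecidableEq α] {l : List α} {a : α}
    (h : (l.head? == some a) = true) : l = a :: l.tail := by
  cases l <;> simp_all

theorem exists_path_of_checkPath {v p : ℕ} (h : checkPath v p) :
    ∃ W : (hypercube 4).Walk (word 0) (word v), W.IsPath ∧ (∀ a, a ∈ W.support) ∧
      ∀ a < 16, ∀ b < 16, (pathMask p).testBit (16 * a + b) → s(word a, word b) ∈ W.edges := by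
  simp only [checkPath, Bool.and_eq_true] at h
  obtain ⟨⟨h0, hw⟩, hl⟩ := h
  have h0 := List.eq_cons_tail_of_head? h0
  have hlt : ∀ c ∈ hexDigits 16 p, c < 16 := fun _ => lt_of_mem_hexDigits
  obtain ⟨W, hW, hWe⟩ := exists_walk_of_isCodeWalk hw (by rwa [← h0])
  rw [← h0] at hW
  refine ⟨W, ?_, fun a => ?_, hWe⟩
  · rw [SimpleGraph.Walk.isPath_def, hW]
    exact nodup_map_word_of_isCodeList hl hlt
  · rw [hW]
    exact mem_map_word_of_isCodeList hl a

theorem exists_twoPath_of_checkTwoPath {v x y p : ℕ} (h : checkTwoPath v x y p) :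
    ∃ (P : (hypercube 4).Walk (word 0) (word v)) (Q : (hypercube 4).Walk (word x) (word y)),
      IsSpanningTwoPath P Q ∧
      ∀ a < 16, ∀ b < 16, (twoPathMask v x p).testBit (16 * a + b) →
        s(word a, word b) ∈ P.edges ∨ s(word a, word b) ∈ Q.edges := by
  simp only [checkTwoPath, Bool.and_eq_true] at h
  obtain ⟨⟨⟨⟨h0, hx⟩, hP⟩, hQ⟩, hl⟩ := h
  have h0 := List.eq_cons_tail_of_head? h0
  have hx := List.eq_cons_tail_of_head? hx
  have hlt : ∀ c ∈ hexDigits 16 p, c < 16 := fun _ => lt_of_mem_hexDigits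
  obtain ⟨P, hPs, hPe⟩ := exists_walk_of_isCodeWalk hP
    (by rw [← h0]; exact fun c hc => hlt c (List.mem_of_mem_take hc))
  obtain ⟨Q, hQs, hQe⟩ := exists_walk_of_isCodeWalk hQ
    (by rw [← hx]; exact fun c hc => hlt c (List.mem_of_mem_drop hc))
  rw [← h0] at hPs
  rw [← hx] at hQs
  have hPQ : P.support ++ Q.support = (hexDigits 16 p).map word := by
    rw [hPs, hQs, ← List.map_append, leftPart, rightPart, List.take_append_drop]
  have hnd := nodup_map_word_of_isCodeList hl hlt
  rw [← hPQ, List.nodup_append] at hnd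
  refine ⟨P, Q, ⟨(SimpleGraph.Walk.isPath_def _).2 hnd.1, (SimpleGraph.Walk.isPath_def _).2 hnd.2.1,
    fun a ha hb => hnd.2.2 a ha a hb rfl, fun a => ?_⟩, fun a ha b hb hab => ?_⟩
  · rw [← List.mem_append, hPQ]
    exact mem_map_word_of_isCodeList hl a
  · rw [twoPathMask, Nat.testBit_or, Bool.or_eq_true] at hab
    exact hab.imp (hPe a ha b hb) (hQe a ha b hb)

theorem meetsOnce_of_touchedOnce {S : Finset (Sym2 (Fin 4 → Bool))} {c : ℕ}
    (h : TouchedOnce S (word c)) {e f : ℕ × ℕ} (he : e ∈ codeEdges) (hf : f ∈ codeEdges)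
    (heS : s(word e.1, word e.2) ∈ S) (hfS : s(word f.1, word f.2) ∈ S) : meetsOnce c e f := by
  -- Each edge is listed in one orientation only, so equal edges have equal code pairs.
  have key : ∀ e ∈ codeEdges, ∀ f ∈ codeEdges, e.1 = f.2 → e.2 = f.1 → False := by decide +kernel
  simp only [meetsOnce, Bool.or_eq_true, beq_iff_eq, Bool.not_eq_true', Bool.and_eq_false_iff,
    Bool.or_eq_false_iff, beq_eq_false_iff_ne]
  by_contra! hcon
  obtain ⟨hne, h1, h2⟩ := hcon
  have h1 : word c ∈ s(word e.1, word e.2) := by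
    by_cases hc : e.1 = c
    · simp [hc]
    · simp [h1 hc]
  have h2 : word c ∈ s(word f.1, word f.2) := by
    by_cases hc : f.1 = c
    · simp [hc]
    · simp [h2 hc]
  have he' := mem_codeEdges_lt e he
  have hf' := mem_codeEdges_lt f hf
  have := h _ heS _ hfS h1 h2
  rw [Sym2.eq_iff, word_inj he'.1 hf'.1, word_inj he'.2 hf'.2, word_inj he'.1 hf'.2,
    word_inj he'.2 hf'.1] at this
  rcases this with h | h
  · exact hne (Prod.ext h.1 h.2)
  · exact key e he f hf h.1 h.2

theorem avoidsCode_of_forall_notMem {S : Finset (Sym2 (Fin 4 → Bool))} {c : ℕ}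
    (h : ∀ e ∈ S, word c ∉ e) {e : ℕ × ℕ} (heS : s(word e.1, word e.2) ∈ S) : avoidsCode c e := by
  have := h _ heS
  simp only [avoidsCode, Bool.and_eq_true, bne_iff_ne]
  constructor
  · rintro rfl
    simp at this
  · rintro rfl
    simp at this

theorem exists_codes_of_card_le {S : Finset (Sym2 (Fin 4 → Bool))} (hne : S.Nonempty)
    (hc : S.card ≤ 2) (hS : ∀ e ∈ S, e ∈ (hypercube 4).edgeSet) :
    ∃ e ∈ codeEdges, ∃ f ∈ codeEdges, s(word e.1, word e.2) ∈ S ∧ s(word f.1, word f.2) ∈ S ∧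
      ∀ g ∈ S, g = s(word e.1, word e.2) ∨ g = s(word f.1, word f.2) := by
  obtain ⟨e, he, f, hf, hef⟩ := Finset.exists_forall_mem_eq_or_eq hne hc
  obtain ⟨e, he', rfl⟩ := exists_mem_codeEdges (hS e he)
  obtain ⟨f, hf', rfl⟩ := exists_mem_codeEdges (hS f hf)
  exact ⟨e, he', f, hf', he, hf, hef⟩

theorem pairTraceable_of_checkHamiltonian {v : ℕ} {T : List ℕ} (h : checkHamiltonian v T) :
    PairTraceable (hypercube 4) (word 0) (word v) := by
  simp only [checkHamiltonian, Bool.and_eq_true, List.all_eq_true] at h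
  obtain ⟨⟨⟨-, hne⟩, hT⟩, hcov⟩ := h
  intro S hc hS huv hu hv
  rcases S.eq_empty_or_nonempty with rfl | hSne
  · obtain ⟨p, hp⟩ := List.exists_mem_of_ne_nil T (by rintro rfl; simp at hne)
    obtain ⟨W, hW, hWs, -⟩ := exists_path_of_checkPath (hT p hp)
    exact ⟨W, hW, hWs, by simp⟩
  · obtain ⟨e, he, f, hf, heS, hfS, hef⟩ := exists_codes_of_card_le hSne hc hS
    have hok : ∀ e : ℕ × ℕ, s(word e.1, word e.2) ∈ S → (!(e.1 == 0 && e.2 == v)) = true := by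
      intro e he
      rw [Bool.not_eq_true', Bool.and_eq_false_iff, beq_eq_false_iff_ne, beq_eq_false_iff_ne]
      by_contra! h
      exact huv (h.1 ▸ h.2 ▸ he)
    obtain ⟨k, hk, hke, hkf⟩ := exists_mem_of_coversPairs hcov (List.mem_filter.2 ⟨he, hok e heS⟩)
      (List.mem_filter.2 ⟨hf, hok f hfS⟩)
      (by rw [Bool.and_eq_true]
          exact ⟨meetsOnce_of_touchedOnce hu he hf heS hfS,
            meetsOnce_of_touchedOnce hv he hf heS hfS⟩)
    obtain ⟨p, hp, rfl⟩ := List.mem_map.1 hk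
    obtain ⟨W, hW, hWs, hWe⟩ := exists_path_of_checkPath (hT p hp)
    have he' := mem_codeEdges_lt e he
    have hf' := mem_codeEdges_lt f hf
    refine ⟨W, hW, hWs, fun g hg => ?_⟩
    rcases hef g hg with rfl | rfl
    · exact hWe _ he'.1 _ he'.2 hke
    · exact hWe _ hf'.1 _ hf'.2 hkf

theorem pairLinkable_of_checkLinked {v x y : ℕ} {T : List ℕ} (h : checkLinked v x y T) :
    PairLinkable (hypercube 4) (word 0) (word v) (word x) (word y) := by
  simp only [checkLinked, Bool.and_eq_true, List.all_eq_true] at h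
  obtain ⟨⟨⟨-, hne⟩, hT⟩, hcov⟩ := h
  intro S hc hS hx hy hu hv
  rcases S.eq_empty_or_nonempty with rfl | hSne
  · obtain ⟨p, hp⟩ := List.exists_mem_of_ne_nil T (by rintro rfl; simp at hne)
    obtain ⟨P, Q, hPQ, -⟩ := exists_twoPath_of_checkTwoPath (hT p hp)
    exact ⟨P, Q, hPQ, by simp⟩
  · obtain ⟨e, he, f, hf, heS, hfS, hef⟩ := exists_codes_of_card_le hSne hc hS
    have hok : ∀ e : ℕ × ℕ, s(word e.1, word e.2) ∈ S →
        (avoidsCode x e && avoidsCode y e) = true := fun e he => by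
      rw [Bool.and_eq_true]
      exact ⟨avoidsCode_of_forall_notMem hx he, avoidsCode_of_forall_notMem hy he⟩
    obtain ⟨k, hk, hke, hkf⟩ := exists_mem_of_coversPairs hcov (List.mem_filter.2 ⟨he, hok e heS⟩)
      (List.mem_filter.2 ⟨hf, hok f hfS⟩)
      (by rw [Bool.and_eq_true]
          exact ⟨meetsOnce_of_touchedOnce hu he hf heS hfS,
            meetsOnce_of_touchedOnce hv he hf heS hfS⟩)
    obtain ⟨p, hp, rfl⟩ := List.mem_map.1 hk
    obtain ⟨P, Q, hPQ, hPQe⟩ := exists_twoPath_of_checkTwoPath (hT p hp)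
    have he' := mem_codeEdges_lt e he
    have hf' := mem_codeEdges_lt f hf
    refine ⟨P, Q, hPQ, fun g hg => ?_⟩
    rcases hef g hg with rfl | rfl
    · exact hPQe _ he'.1 _ he'.2 hke
    · exact hPQe _ hf'.1 _ hf'.2 hkf

theorem word_zero : word 0 = fun _ => false := by
  funext i
  simp [word]

theorem hasPathsThroughPairs_four : HasPathsThroughPairs 4 := by
  intro S u v hc hS hp
  -- Translation by `u` moves `u` to `0`, and so `v` to an odd vertex.
  have hv : parity (cubeIso 1 u v) = 1 := by
    revert u v
    decide +kernel
  obtain ⟨σ, hσ⟩ := exists_perm_mem_hamiltonianTable _ hv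
  obtain ⟨r, hr, hrv⟩ := List.mem_map.1 hσ
  have h := pairTraceable_of_checkHamiltonian (List.all_eq_true.1 hamiltonianTable_check r hr)
  rw [hrv, word_wordCode] at h
  refine PairTraceable.of_iso (cubeIso 1 u) (PairTraceable.of_iso (cubeIso σ fun _ => false) ?_)
    S hc hS
  convert h using 1
  · funext i
    simp [cubeIso, word_zero]
  · funext i
    simp [cubeIso]

theorem hasTwoPathsThroughPairs_four : HasTwoPathsThroughPairs 4 := by
  intro S u v x y h
  -- Exactly one of `x`, `y` has the parity of `u`. After exchanging them if necessary, translation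
  -- by `u` makes `x` even and `y` odd, as the table requires.
  wlog hux : parity u = parity x generalizing x y
  · refine (this y x h.swap_right ?_).swap_right
    have := h.parity_right
    have := parity_lt_two u
    have := parity_lt_two x
    have := parity_lt_two y
    omega
  have key : ∀ a b : Fin 4 → Bool,
      parity (cubeIso 1 a b) = if parity a = parity b then 0 else 1 := by
    decide +kernel
  have huy : parity u ≠ parity y := hux ▸ h.parity_right
  have hne : wordCode (cubeIso 1 u x) ≠ 0 := fun h0 => h.ux <| by
    have h1 := word_wordCode (cubeIso 1 u x)
    rw [h0, word_zero] at h1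
    funext i
    have := congrFun h1 i
    simp [cubeIso] at this
    exact this.symm
  obtain ⟨σ, hσ⟩ := exists_perm_mem_twoPathTable (cubeIso 1 u v)
    ((key u v).trans (if_neg h.parity_left)) (cubeIso 1 u x) ((key u x).trans (if_pos hux)) hne
    (cubeIso 1 u y) ((key u y).trans (if_neg huy)) ((cubeIso 1 u).injective.ne h.vy)
  obtain ⟨r, hr, hrv⟩ := List.any_eq_true.1 hσ
  have hrv := Nat.eq_of_beq_eq_true hrv
  have hcheck := List.all_eq_true.1 twoPathTable_check r hr
  have hlink := pairLinkable_of_checkLinked hcheck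
  simp only [checkLinked, Bool.and_eq_true, Nat.blt_eq] at hcheck
  have h1 := wordCode_lt (cubeIso 1 u v ∘ σ)
  have h2 := wordCode_lt (cubeIso 1 u x ∘ σ)
  have h3 := wordCode_lt (cubeIso 1 u y ∘ σ)
  obtain ⟨⟨⟨⟨⟨ha, hb⟩, hc⟩, -⟩, -⟩, -⟩ := hcheck
  -- The packed numbers agree and all their base 16 digits are below 16, so the triples agree.
  rw [show r.1.1 = wordCode (cubeIso 1 u v ∘ σ) by omega,
    show r.1.2.1 = wordCode (cubeIso 1 u x ∘ σ) by omega,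
    show r.1.2.2 = wordCode (cubeIso 1 u y ∘ σ) by omega,
    word_wordCode, word_wordCode, word_wordCode] at hlink
  refine PairLinkable.of_iso (cubeIso 1 u) (PairLinkable.of_iso (cubeIso σ fun _ => false) ?_)
    S h.card_le h.mem_edgeSet h.notMem_x h.notMem_y h.once_u h.once_v
  convert hlink using 1
  · funext i
    simp [cubeIso, word_zero]
  all_goals
    funext i
    simp [cubeIso]

end words

/-! ### The induction and the theorem -/

theorem hasPathsThroughPairs {n : ℕ} (hn : 4 ≤ n) : HasPathsThroughPairs n := by
  induction n, hn using Nat.le_induction with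
  | base => exact hasPathsThroughPairs_four
  | succ m hm ih => exact ih.succ hm

theorem hasTwoPathsThroughPairs {n : ℕ} (hn : 4 ≤ n) : HasTwoPathsThroughPairs n := by
  induction n, hn using Nat.le_induction with
  | base => exact hasTwoPathsThroughPairs_four
  | succ m hm ih => exact ih.succ hm (hasPathsThroughPairs hm)

theorem lemma2p6 (n : ℕ) (hn : 6 ≤ n)
    (e₁ e₂ : Sym2 (Fin n → Bool))
    (he₁ : e₁ ∈ (hypercube n).edgeSet) (he₂ : e₂ ∈ (hypercube n).edgeSet)
    (u v x y : Fin n → Bool)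
    (huv : u ≠ v) (hux : u ≠ x) (huy : u ≠ y) (hvx : v ≠ x) (hvy : v ≠ y) (hxy : x ≠ y)
    (hpuv : parity u ≠ parity v) (hpxy : parity x ≠ parity y)
    (hx₁ : x ∉ e₁) (hy₁ : y ∉ e₁) (hx₂ : x ∉ e₂) (hy₂ : y ∉ e₂)
    (hu : e₁ ≠ e₂ → ¬ (u ∈ e₁ ∧ u ∈ e₂)) (hv : e₁ ≠ e₂ → ¬ (v ∈ e₁ ∧ v ∈ e₂)) :
    ∃ (P : (hypercube n).Walk u v) (Q : (hypercube n).Walk x y),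
      IsSpanningTwoPath P Q ∧
        (e₁ ∈ P.edges ∨ e₁ ∈ Q.edges) ∧ (e₂ ∈ P.edges ∨ e₂ ∈ Q.edges) := by
  -- The set `{e₁, e₂}` collapses to one edge if `e₁ = e₂`; otherwise the condition at `u` and `v`
  -- is exactly that they do not lie on both edges.
  have once : ∀ w : Fin n → Bool, (e₁ ≠ e₂ → ¬ (w ∈ e₁ ∧ w ∈ e₂)) → TouchedOnce {e₁, e₂} w := by
    intro w hw e he f hf hwe hwf
    simp only [Finset.mem_insert, Finset.mem_singleton] at he hf
    by_contra hne
    rcases he with rfl | rfl <;> rcases hf with rfl | rfl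
    · exact hne rfl
    · exact hw hne ⟨hwe, hwf⟩
    · exact hw (Ne.symm hne) ⟨hwf, hwe⟩
    · exact hne rfl
  obtain ⟨P, Q, hPQ, hS⟩ := hasTwoPathsThroughPairs (n := n) (by omega) {e₁, e₂} u v x y
    { card_le := Finset.card_le_two
      mem_edgeSet := by simp [he₁, he₂]
      parity_left := hpuv
      parity_right := hpxy
      ux := hux
      uy := huy
      vx := hvx
      vy := hvy
      notMem_x := by simp [hx₁, hx₂]
      notMem_y := by simp [hy₁, hy₂]
      once_u := once u hu
      once_v := once v hv }
  exact ⟨P, Q, hPQ, hS e₁ (by simp), hS e₂ (by simp)⟩
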